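/- **Definitions.** Graphs are finite and simple. A *cograph* is a graph with no induced path on four vertices. The *edit* of $G=(V,E)$ by a set $S$ of pairs of vertices is $(V,E\mathbin{\triangle}S)$; $S$ is a *minimum cograph edit* of $G$ if this edit is a cograph and $|S|$ is smallest possible. A *module* of $G$ is a set $X\subseteq V$ all of whose vertices have the same neighbourhood in $V\setminus X$; a *comodule* is a module that is a connected component of $G$ or of the complement of $G$; a *$t$-module* is a set that becomes a module after editing at most $t$ pairs. The instance $(G,k)$ is *reduced under the first three rules* if (1) no comodule of $G$ induces a cograph, (2) no module of more than $k+1$ vertices is an independent set, (3) every module $X$ such that $G[X]$ contains an edge is a comodule. A *nested $t$-module* of $(G,k)$ is a partition of $V$ into five nonempty sets $A,B,C,K,I$ such that $A$, $A\cup B$, $A\cup B\cup C$ are $t$-modules, $|A|>k+t$, and each of the following sets has at least $3t+1$ elements: $B_\oplus$ (resp. $B_+$), the vertices of $B$ adjacent to all of $K$, to none of $I$ and to all (resp. none) of $A$; $C_\oplus$ (resp. $C_+$), the vertices of $C$ adjacent to all of $K$, to none of $I$ and to all (resp. none) of $A\cup B$. The *nested $t$-module rule* edits every edge between $A$ and $I$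 and every non-edge between $A$ and $K$; it *applies* if there is a nested $t$-module with at least one such pair to edit. Let $H$ be the edit of $G$ by a minimum cograph edit $S$ with $|S|\le k$, and let $T$ be the canonical cotree of $H$: a rooted tree whose leaves are the vertices of $H$, whose internal nodes have at least two children and are labelled $+$ or $\oplus$, labels alternating between an internal node and its internal children, such that $xy$ is an edge of $H$ if and only if the closest common ancestor of $x$ and $y$ is labelled $\oplus$. For a node $u$ let $De(u)$ be the set of leaves below $u$ (or equal to $u$). $T'$ is the subtree of $T$ induced by the nodes $u$ with $|De(u)|\ge k+2$. Each pair $xy\in S$, with closest common ancestor $z$ in $T$, yields two *edit paths*, the descending paths of $T$ from $z$ to $x$ and from $z$ to $y$ (counted with multiplicity). $T''$ is the forest obtained from $T'$ by removing the edges that belong to no edit path. A descending path $Q$ of $T''$ with at least one edge that is a subpath of some edit path is *$c$-sparse* if at most $|E(Q)|/c$ edit paths share an edge with $Q$. **Theorem.** Let $(G,k)$ be reduced under the first three rules, let $S$ be a minimum cograph edit of $G$ with $|S|\le k$, and let $T''$ be the forest above. If $T''$ has a $51$-sparse path, then for some $t$ the graph $G$ has a nested $t$-module $A,B,C,K,I$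 to which the nested $t$-module rule applies. It can moreover be chosen so that it is determined by six vertices $x,x',y,y',z,z'$: writing $D(p,q)$ for the set of vertices adjacent to exactly one of $p,q$, one has $A=D(x,x')$, $B=D(y,y')\setminus A$, $C=D(z,z')\setminus(A\cup B)$, $K$ is the set of vertices outside $A\cup B\cup C$ adjacent to $x$, and $I$ is the set of remaining vertices. Moreover, such a nested $t$-module can be detected in polynomial time: there is one random access machine program (unit cost, with addition and subtraction but no multiplication, reading the adjacency matrix) which on every input $(G,k)$ with $n$ vertices halts after a number of steps bounded by a fixed polynomial in $n$, and either reports nothing or outputs $t$ and a nested $t$-module $A,B,C,K,I$ of $(G,k)$ to which the rule applies; and it does output one whenever $(G,k)$ is reduced under the first three rules and, for some minimum cograph edit $S$ with $|S|\le k$, the forest $T''$ has a $51$-sparse path. -/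

import Mathlib

open scoped symmDiff

namespace CographEdit

/-! ## Graphs, edits, modules -/

section Graphs

variable {V : Type*}

/-- A cograph is a graph without induced path on four vertices. -/
def IsCograph (G : SimpleGraph V) : Prop :=
  IsEmpty (SimpleGraph.pathGraph 4 ↪g G)

/-- The edit of `G = (V, E)` by a set `S` of (unordered) pairs: the simple graph `(V, E ∆ S)`.
Pairs on the diagonal have no effect. -/
def edit (G : SimpleGraph V) (S : Finset (Sym2 V)) : SimpleGraph V :=
  SimpleGraph.fromEdgeSet (G.edgeSet ∆ (S : Set (Sym2 V)))

/-- `S` is a minimum cograph edit of `G`. (By minimality such an `S` has no diagonal pair.) -/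
def IsMinCographEdit (G : SimpleGraph V) (S : Finset (Sym2 V)) : Prop :=
  IsCograph (edit G S) ∧ ∀ S' : Finset (Sym2 V), IsCograph (edit G S') → S.card ≤ S'.card

/-- All vertices of `X` have the same neighbourhood outside `X`. -/
def IsModule (G : SimpleGraph V) (X : Set V) : Prop :=
  ∀ x ∈ X, ∀ y ∈ X, ∀ z, z ∉ X → (G.Adj x z ↔ G.Adj y z)

/-- A module that is a connected component of `G` or of the complement of `G`. -/
def IsComodule (G : SimpleGraph V) (M : Set V) : Prop :=
  IsModule G M ∧
    ((∃ c : G.ConnectedComponent, c.supp = M) ∨ (∃ c : Gᶜ.ConnectedComponent, c.supp = M))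

/-- `G[X]` has no edge. -/
def IsIndependent (G : SimpleGraph V) (X : Set V) : Prop :=
  ∀ x ∈ X, ∀ y ∈ X, ¬ G.Adj x y

/-- The comodule rule applies: some comodule induces a cograph. -/
def ComoduleRuleApplies (G : SimpleGraph V) : Prop :=
  ∃ C : Set V, IsComodule G C ∧ IsCograph (G.induce C)

/-- The module reduction rule applies: some module with more than `k + 1` vertices is an
independent set. -/
def ModuleReductionRuleApplies (G : SimpleGraph V) (k : ℕ) : Prop :=
  ∃ M : Set V, IsModule G M ∧ k + 1 < M.ncard ∧ IsIndependent G M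

/-- The module extraction rule applies: some module that is not a comodule contains an edge. -/
def ModuleExtractionRuleApplies (G : SimpleGraph V) : Prop :=
  ∃ X : Set V, IsModule G X ∧ ¬ IsComodule G X ∧ ¬ IsIndependent G X

/-- `(G, k)` is reduced under the first three reduction rules. -/
def IsReducedInstance (G : SimpleGraph V) (k : ℕ) : Prop :=
  ¬ ComoduleRuleApplies G ∧ ¬ ModuleReductionRuleApplies G k ∧ ¬ ModuleExtractionRuleApplies G

/-- `X` becomes a module after editing at most `t` pairs. -/
def IsTModule (G : SimpleGraph V) (t : ℕ) (X : Set V) : Prop :=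
  ∃ T : Finset (Sym2 V), T.card ≤ t ∧ IsModule (edit G T) X

/-- The vertices of `Y` that are adjacent to all of `X` and all of `K` and to none of `I`. -/
def joinedPart (G : SimpleGraph V) (Y X K I : Set V) : Set V :=
  {b ∈ Y | (∀ a ∈ X, G.Adj b a) ∧ (∀ c ∈ K, G.Adj b c) ∧ ∀ i ∈ I, ¬ G.Adj b i}

/-- The vertices of `Y` that are adjacent to all of `K` and to none of `X` and none of `I`. -/
def separatedPart (G : SimpleGraph V) (Y X K I : Set V) : Set V :=
  {b ∈ Y | (∀ a ∈ X, ¬ G.Adj b a) ∧ (∀ c ∈ K, G.Adj b c) ∧ ∀ i ∈ I, ¬ G.Adj b i}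

/-- `A, B, C, K, I` is a nested `t`-module of the instance `(G, k)`. -/
structure IsNestedTModule (G : SimpleGraph V) (k t : ℕ) (A B C K I : Set V) : Prop where
  nonempty : A.Nonempty ∧ B.Nonempty ∧ C.Nonempty ∧ K.Nonempty ∧ I.Nonempty
  cover : A ∪ B ∪ C ∪ K ∪ I = Set.univ
  disjoint : [A, B, C, K, I].Pairwise Disjoint
  tmodule_A : IsTModule G t A
  tmodule_AB : IsTModule G t (A ∪ B)
  tmodule_ABC : IsTModule G t (A ∪ B ∪ C)
  card_A : k + t < A.ncard
  card_B_join : 3 * t + 1 ≤ (joinedPart G B A K I).ncard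
  card_B_sep : 3 * t + 1 ≤ (separatedPart G B A K I).ncard
  card_C_join : 3 * t + 1 ≤ (joinedPart G C (A ∪ B) K I).ncard
  card_C_sep : 3 * t + 1 ≤ (separatedPart G C (A ∪ B) K I).ncard

/-- The nested `t`-module rule, which edits every edge between `A` and `I` and every non-edge
between `A` and `K`, applies to `A, B, C, K, I`: this is a nested `t`-module, and there is at least
one pair to edit. -/
def NestedRuleApplies (G : SimpleGraph V) (k t : ℕ) (A B C K I : Set V) : Prop :=
  IsNestedTModule G k t A B C K I ∧
    ((∃ a ∈ A, ∃ i ∈ I, G.Adj a i) ∨ (∃ a ∈ A, ∃ c ∈ K, ¬ G.Adj a c))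

/-- The vertices adjacent to exactly one of `x` and `x'`. -/
def distinguishers (G : SimpleGraph V) (x x' : V) : Set V :=
  {a | Xor (G.Adj a x) (G.Adj a x')}

/-- The five sets are computed from the six vertices `x, x', y, y', z, z'`. -/
def DeterminedBy (G : SimpleGraph V) (x x' y y' z z' : V) (A B C K I : Set V) : Prop :=
  A = distinguishers G x x' ∧
  B = distinguishers G y y' \ A ∧
  C = distinguishers G z z' \ (A ∪ B) ∧
  K = {s | s ∉ A ∪ B ∪ C ∧ G.Adj s x} ∧
  I = {s | s ∉ A ∪ B ∪ C ∧ ¬ G.Adj s x}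

end Graphs

/-! ## Rooted trees, cotrees, edit paths -/

/-- A rooted tree on the node set `N`, given by its parent map (the root is sent to itself). -/
structure RootedTree (N : Type*) where
  root : N
  parent : N → N
  parent_root : parent root = root
  reaches_root : ∀ u, ∃ i : ℕ, parent^[i] u = root

namespace RootedTree

variable {N : Type*} (T : RootedTree N)

/-- `v` is a child of `u`. -/
def IsChild (v u : N) : Prop := v ≠ T.root ∧ T.parent v = u

/-- `u` has no child. -/
def IsLeaf (u : N) : Prop := ∀ v, ¬ T.IsChild v u

/-- `a` is an ancestor of `u` (every node is an ancestor of itself). -/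
def Anc (a u : N) : Prop := ∃ i : ℕ, T.parent^[i] u = a

/-- `z` is the closest common ancestor of `u` and `v`. -/
def IsLCA (z u v : N) : Prop :=
  T.Anc z u ∧ T.Anc z v ∧ ∀ b, T.Anc b u → T.Anc b v → T.Anc b z

/-- The edges of the descending path from `a` to its descendant `b`. An edge of the tree, joining
a non-root node `u` to its parent, is represented by its lower end `u`. -/
def descEdges (a b : N) : Set N := {u | T.Anc a u ∧ u ≠ a ∧ T.Anc u b}

end RootedTree

/-- A canonical cotree of `H`, on the node set `N`: a rooted tree whose leaves are identified with
the vertices of `H`, whose internal nodes have at least two children and carry a label (`true` for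
`⊕`, `false` for `+`; the label of a leaf plays no role), labels alternating between an internal
node and its internal children, such that two vertices are adjacent iff their closest common
ancestor has label `⊕`. -/
structure Cotree {V : Type*} (H : SimpleGraph V) (N : Type*) extends RootedTree N where
  leaf : V → N
  leaf_injective : Function.Injective leaf
  range_leaf : Set.range leaf = {u | toRootedTree.IsLeaf u}
  label : N → Bool
  two_children : ∀ u, ¬ toRootedTree.IsLeaf u →
    ∃ v w, v ≠ w ∧ toRootedTree.IsChild v u ∧ toRootedTree.IsChild w u
  label_alternates : ∀ u v, toRootedTree.IsChild v u → ¬ toRootedTree.IsLeaf v →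
    label v ≠ label u
  adj_iff : ∀ x y z, x ≠ y → toRootedTree.IsLCA z (leaf x) (leaf y) →
    (H.Adj x y ↔ label z = true)

namespace Cotree

variable {V N : Type*} {H : SimpleGraph V} (T : Cotree H N)

/-- The vertices of `H` that are descendants of the node `u`. -/
def De (u : N) : Set V := {x | T.Anc u (T.leaf x)}

/-- The edges of the descending path from the closest common ancestor of `x` and `y` to `x`. An
edited pair `xy` yields the two edit paths `(x, y)` and `(y, x)`. -/
def editPathEdges (x y : V) : Set N :=
  {u | ∃ z, T.IsLCA z (T.leaf x) (T.leaf y) ∧ u ∈ T.descEdges z (T.leaf x)}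

/-- The edges of `T'`, the subtree induced by the nodes `u` with `|De(u)| ≥ k + 2`. -/
def bigEdges (k : ℕ) : Set N :=
  {u | u ≠ T.root ∧ k + 2 ≤ (T.De u).ncard ∧ k + 2 ≤ (T.De (T.parent u)).ncard}

/-- The edges of `T''`: the edges of `T'` that belong to an edit path. -/
def forestEdges (S : Finset (Sym2 V)) (k : ℕ) : Set N :=
  {u ∈ T.bigEdges k | ∃ x y, s(x, y) ∈ S ∧ u ∈ T.editPathEdges x y}

/-- The edit paths, indexed by ordered pairs `(x, y)` and thus counted with multiplicity, that
share an edge with the descending path from `a` to `b`. -/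
def editPathsMeeting (S : Finset (Sym2 V)) (a b : N) : Set (V × V) :=
  {p | s(p.1, p.2) ∈ S ∧ (T.descEdges a b ∩ T.editPathEdges p.1 p.2).Nonempty}

/-- The descending path `Q` from `a` to `b` is a `c`-sparse path of `T''` with respect to the edit
paths: it lies in `T''`, has at least one edge, is a subpath of an edit path, and shares an edge
with at most `|E(Q)| / c` edit paths. -/
def IsSparsePath (S : Finset (Sym2 V)) (k c : ℕ) (a b : N) : Prop :=
  T.Anc a b ∧ a ≠ b ∧
  T.descEdges a b ⊆ T.forestEdges S k ∧
  (∃ x y, s(x, y) ∈ S ∧ T.descEdges a b ⊆ T.editPathEdges x y) ∧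
  c * (T.editPathsMeeting S a b).ncard ≤ (T.descEdges a b).ncard

end Cotree

/-! ## A random access machine with step count -/

/-- A state of the machine: registers and an array, with natural numbers as values. -/
structure State where
  reg : ℕ → ℕ
  mem : ℕ → ℕ

/-- Programs of a random access machine. The input graph is a read-only adjacency matrix. There is
no multiplication, so that unit cost per instruction is polynomially related to bit cost. -/
inductive Program
  /-- `reg r := c` -/
  | const (r c : ℕ)
  /-- `reg r := reg a + reg b` -/
  | add (r a b : ℕ)
  /-- `reg r := reg a - reg b`, truncated at `0` -/
  | sub (r a b : ℕ)
  /-- `reg r := mem (reg a)` -/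
  | load (r a : ℕ)
  /-- `mem (reg a) := reg r` -/
  | store (a r : ℕ)
  /-- `reg r := 1` if the vertices `reg a` and `reg b` are adjacent, `reg r := 0` otherwise -/
  | query (r a b : ℕ)
  /-- `p` followed by `q` -/
  | seq (p q : Program)
  /-- `p` if `reg r ≠ 0`, otherwise `q` -/
  | ite (r : ℕ) (p q : Program)
  /-- repeat `p` while `reg r ≠ 0` -/
  | while (r : ℕ) (p : Program)

namespace State

/-- Write `v` into register `r`. -/
def setReg (s : State) (r v : ℕ) : State := { s with reg := Function.update s.reg r v }

/-- Write `v` into array cell `a`. -/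
def setMem (s : State) (a v : ℕ) : State := { s with mem := Function.update s.mem a v }

/-- The initial state on input `(G, k)` with `n` vertices: `n` and `k` are in registers `0` and
`1`; everything else is `0`. -/
def init (n k : ℕ) : State where
  reg := fun r => if r = 0 then n else if r = 1 then k else 0
  mem := fun _ => 0

/-- The vertices of label `j` in the array. -/
def cls (s : State) (n j : ℕ) : Set (Fin n) := {v | s.mem v = j}

end State

open Classical in
/-- The entry `(i, j)` of the adjacency matrix of `G` (and `0` outside the matrix). -/
noncomputable def adjEntry {n : ℕ} (G : SimpleGraph (Fin n)) (i j : ℕ) : ℕ :=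
  if ∃ (hi : i < n) (hj : j < n), G.Adj ⟨i, hi⟩ ⟨j, hj⟩ then 1 else 0

/-- `Exec G p s τ s'`: on the input graph `G`, the program `p` started in state `s` halts after
exactly `τ` steps in state `s'`. Every instruction and every test of a register costs one step. -/
inductive Exec {n : ℕ} (G : SimpleGraph (Fin n)) : Program → State → ℕ → State → Prop
  | const (r c : ℕ) (s : State) : Exec G (.const r c) s 1 (s.setReg r c)
  | add (r a b : ℕ) (s : State) : Exec G (.add r a b) s 1 (s.setReg r (s.reg a + s.reg b))
  | sub (r a b : ℕ) (s : State) : Exec G (.sub r a b) s 1 (s.setReg r (s.reg a - s.reg b))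
  | load (r a : ℕ) (s : State) : Exec G (.load r a) s 1 (s.setReg r (s.mem (s.reg a)))
  | store (a r : ℕ) (s : State) : Exec G (.store a r) s 1 (s.setMem (s.reg a) (s.reg r))
  | query (r a b : ℕ) (s : State) :
      Exec G (.query r a b) s 1 (s.setReg r (adjEntry G (s.reg a) (s.reg b)))
  | seq {p q : Program} {s s₁ s₂ : State} {τ₁ τ₂ : ℕ} :
      Exec G p s τ₁ s₁ → Exec G q s₁ τ₂ s₂ → Exec G (.seq p q) s (τ₁ + τ₂) s₂
  | ite_true {r : ℕ} {p q : Program} {s s' : State} {τ : ℕ} :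
      s.reg r ≠ 0 → Exec G p s τ s' → Exec G (.ite r p q) s (τ + 1) s'
  | ite_false {r : ℕ} {p q : Program} {s s' : State} {τ : ℕ} :
      s.reg r = 0 → Exec G q s τ s' → Exec G (.ite r p q) s (τ + 1) s'
  | while_true {r : ℕ} {p : Program} {s s₁ s₂ : State} {τ₁ τ₂ : ℕ} :
      s.reg r ≠ 0 → Exec G p s τ₁ s₁ → Exec G (.while r p) s₁ τ₂ s₂ →
        Exec G (.while r p) s (τ₁ + τ₂ + 1) s₂
  | while_false {r : ℕ} {p : Program} {s : State} :
      s.reg r = 0 → Exec G (.while r p) s 1 s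

end CographEdit

open CographEdit

/-! Let `D i` be the set of leaves below the `i`-th node of a sparse path, counted upwards from its
lower end, and let `t` be the number of edit paths meeting it. The `D i` are nested modules of the
cograph `H`, and consecutive differences `D (i+1) \ D i` are alternately joined to and separated
from `D i`. A pair of `S` leaving some `D i` has an edit path through the corresponding edge, so at
most `t` ordered pairs leave any of these sets: each `D i` is a `t`-module of `G`, and at most `2t`
differences are touched by `S` (`ModuleChain.card_touched_le`).

An untouched difference is a module of `G` with neighbours and non-neighbours outside, so the module
extraction rule makes it independent (`isIndependent_diff`). Hence, if `x` and `x'` lie in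
consecutive untouched differences, the first joined and the second separated, they differ exactly on
the set below them (`distinguishers_eq`). Pigeonhole finds such a pair in every window of about `4t`
levels. Three of them, more than `10t` levels apart, cut out `A`, `A ∪ B`, `A ∪ B ∪ C`; the
untouched differences in between supply the `3t + 1` vertices of each kind, and all of them see the
outside as `x` does, which defines `K` and `I`. Finally, the sparse path is part of an edit path of
some pair `a₀b₀` of `S` with `a₀ ∈ A` and `b₀` outside `A ∪ B ∪ C`. In `H` the vertices `a₀` and `x`
agree on `b₀`, and only `a₀b₀` was edited, so in `G` they disagree: the rule has a pair to edit
(`exists_nestedRuleApplies`).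

For detection, applicability of the rule to the sets determined by six vertices is a fixed
expression with bounded sums, because the distance to being a module splits over the outside
vertices (`isTModule_iff`). Such expressions compile to polynomial-time programs (`runs_compile`,
`exists_cost_le`). The program searches for `t` and the six vertices one at a time and checks the
result (`runs_detect`). -/

namespace CographEdit

/-! ### Ancestors and closest common ancestors in rooted trees. -/

namespace RootedTree

variable {N : Type*} (T : RootedTree N)

theorem Anc.refl (u : N) : T.Anc u u := ⟨0, rfl⟩

variable {T}

theorem Anc.trans {a b c : N} (h : T.Anc a b) (h' : T.Anc b c) : T.Anc a c := by
  obtain ⟨i, rfl⟩ := h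
  obtain ⟨j, rfl⟩ := h'
  exact ⟨i + j, by rw [Function.iterate_add_apply]⟩

theorem iterate_parent_root (i : ℕ) : T.parent^[i] T.root = T.root := by
  induction i with
  | zero => rfl
  | succ i ih => rw [Function.iterate_succ_apply, T.parent_root, ih]

theorem Anc.comparable {a b u : N} (ha : T.Anc a u) (hb : T.Anc b u) : T.Anc a b ∨ T.Anc b a := by
  obtain ⟨i, rfl⟩ := ha
  obtain ⟨j, rfl⟩ := hb
  rcases le_total i j with h | h
  · exact Or.inr ⟨j - i, by rw [← Function.iterate_add_apply, Nat.sub_add_cancel h]⟩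
  · exact Or.inl ⟨i - j, by rw [← Function.iterate_add_apply, Nat.sub_add_cancel h]⟩

/-- Going round the cycle `m` times takes at least `m` steps, where `m` steps reach the root, and
the root is fixed. -/
theorem eq_root_of_iterate_eq {u : N} {i : ℕ} (hi : i ≠ 0) (h : T.parent^[i] u = u) :
    u = T.root := by
  obtain ⟨m, hm⟩ := T.reaches_root u
  have h1 : T.parent^[i * m] u = u := by
    rw [Function.iterate_mul]
    exact Function.iterate_fixed h m
  have h2 : m ≤ i * m := Nat.le_mul_of_pos_left m (Nat.pos_of_ne_zero hi)
  rw [← h1, ← Nat.sub_add_cancel h2, Function.iterate_add_apply, hm, iterate_parent_root]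

theorem Anc.antisymm {a b : N} (h : T.Anc a b) (h' : T.Anc b a) : a = b := by
  obtain ⟨i, hi⟩ := h
  obtain ⟨j, hj⟩ := h'
  rcases Nat.eq_zero_or_pos i with rfl | hpos
  · exact hi.symm
  have hb : b = T.root := by
    refine eq_root_of_iterate_eq (i := j + i) (by omega) ?_
    rw [Function.iterate_add_apply, hi, hj]
  rw [← hi, hb, iterate_parent_root]

theorem anc_parent (u : N) : T.Anc (T.parent u) u := ⟨1, rfl⟩

/-- A proper ancestor is an ancestor of the parent. -/
theorem Anc.parent_of_ne {a u : N} (h : T.Anc a u) (hne : a ≠ u) : T.Anc a (T.parent u) := by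
  obtain ⟨i, rfl⟩ := h
  cases i with
  | zero => exact absurd rfl hne
  | succ i => exact ⟨i, rfl⟩

theorem anc_root (u : N) : T.Anc T.root u := T.reaches_root u

theorem Anc.eq_root {a : N} (h : T.Anc a T.root) : a = T.root := h.antisymm (anc_root a)

theorem exists_isLCA (u v : N) : ∃ z, T.IsLCA z u v := by
  classical
  have hex : ∃ i, T.Anc (T.parent^[i] u) v := by
    obtain ⟨i, hi⟩ := T.reaches_root u
    exact ⟨i, hi ▸ anc_root v⟩
  refine ⟨T.parent^[Nat.find hex] u, ⟨_, rfl⟩, Nat.find_spec hex, ?_⟩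
  rintro b ⟨j, rfl⟩ hb
  have hle := Nat.find_min' hex hb
  exact ⟨j - Nat.find hex, by rw [← Function.iterate_add_apply, Nat.sub_add_cancel hle]⟩

theorem IsLCA.symm {z u v : N} (h : T.IsLCA z u v) : T.IsLCA z v u :=
  ⟨h.2.1, h.1, fun b hb hb' => h.2.2 b hb' hb⟩

/-- Children of a node that have a common descendant are equal. -/
theorem eq_of_isChild {v w u x : N} (hv : T.IsChild v u) (hw : T.IsChild w u)
    (hvx : T.Anc v x) (hwx : T.Anc w x) : v = w := by
  have key : ∀ {v w : N}, T.IsChild v u → T.IsChild w u → T.Anc v w → v = w := by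
    intro v w hv hw h
    by_contra hne
    have h1 := h.parent_of_ne hne
    rw [hw.2] at h1
    have h2 : u = v := Anc.antisymm (hv.2 ▸ anc_parent v) h1
    have h3 : T.parent v = v := hv.2.trans h2
    exact hv.1 (eq_root_of_iterate_eq (i := 1) one_ne_zero h3)
  rcases hvx.comparable hwx with h | h
  · exact key hv hw h
  · exact (key hw hv h).symm

theorem exists_leaf_below [Finite N] (u : N) : ∃ v, T.IsLeaf v ∧ T.Anc u v := by
  let r : N → N → Prop := fun x y => T.Anc y x ∧ x ≠ y
  have : IsTrans N r := ⟨fun x y z h h' => ⟨h'.1.trans h.1, by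
    rintro rfl
    exact h.2 (h'.1.antisymm h.1)⟩⟩
  have : Std.Irrefl r := ⟨fun x h => h.2 rfl⟩
  have wf : WellFounded r := Finite.wellFounded_of_trans_of_irrefl r
  induction u using wf.induction with
  | _ u ih =>
    by_cases hu : T.IsLeaf u
    · exact ⟨u, hu, Anc.refl T u⟩
    · simp only [IsLeaf, not_forall, not_not] at hu
      obtain ⟨v, hv⟩ := hu
      have hav : T.Anc u v := hv.2 ▸ anc_parent v
      have hne : v ≠ u := by
        rintro rfl
        exact hv.1 (eq_root_of_iterate_eq (i := 1) one_ne_zero hv.2)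
      obtain ⟨w, hw, hvw⟩ := ih v ⟨hav, hne⟩
      exact ⟨w, hw, hav.trans hvw⟩

end RootedTree

/-! ### Edits, untouched sets, and modules of reduced instances. -/

theorem edit_adj {V : Type*} (G : SimpleGraph V) (S : Finset (Sym2 V)) (x y : V) :
    (edit G S).Adj x y ↔ Xor (G.Adj x y) (s(x, y) ∈ S) ∧ x ≠ y := by
  simp only [edit, SimpleGraph.fromEdgeSet_adj, Set.mem_symmDiff, SimpleGraph.mem_edgeSet,
    Finset.mem_coe, Xor]

theorem edit_adj_of_notMem {V : Type*} (G : SimpleGraph V) {S : Finset (Sym2 V)} {x y : V}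
    (h : s(x, y) ∉ S) : (edit G S).Adj x y ↔ G.Adj x y := by
  rw [edit_adj]
  constructor
  · rintro ⟨h1 | h1, -⟩
    · exact h1.1
    · exact absurd h1.1 h
  · exact fun h1 => ⟨Or.inl ⟨h1, h⟩, h1.ne⟩

theorem edit_adj_of_mem {V : Type*} (G : SimpleGraph V) {S : Finset (Sym2 V)} {x y : V}
    (h : s(x, y) ∈ S) (hne : x ≠ y) : (edit G S).Adj x y ↔ ¬ G.Adj x y := by
  rw [edit_adj]
  simp [h, hne, Xor]

/-- No pair of `S` has exactly one vertex in `M`. -/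
def Untouched {V : Type*} (S : Finset (Sym2 V)) (M : Set V) : Prop :=
  ∀ v ∈ M, ∀ w, w ∉ M → s(v, w) ∉ S

theorem Untouched.adj_iff {V : Type*} {G : SimpleGraph V} {S : Finset (Sym2 V)} {M : Set V}
    (h : Untouched S M) {v w : V} (hv : v ∈ M) (hw : w ∉ M) :
    G.Adj v w ↔ (edit G S).Adj v w :=
  (edit_adj_of_notMem G (h v hv w hw)).symm

theorem Untouched.isModule {V : Type*} {G : SimpleGraph V} {S : Finset (Sym2 V)} {M : Set V}
    (h : Untouched S M) (hM : IsModule (edit G S) M) : IsModule G M := by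
  intro x hx y hy z hz
  rw [h.adj_iff hx hz, h.adj_iff hy hz]
  exact hM x hx y hy z hz

/-- If few pairs of `S` have exactly one vertex in the module `X` of the edit of `G` by `S`, then
`X` is a `t`-module of `G`. -/
theorem isTModule_of_isModule_edit {V : Type*} {G : SimpleGraph V} {S : Finset (Sym2 V)}
    {X : Set V} (hX : IsModule (edit G S) X) {t : ℕ} {P : Set (V × V)} (hP : P.Finite)
    (ht : P.ncard ≤ t) (hc : ∀ v ∈ X, ∀ w, w ∉ X → s(v, w) ∈ S → (v, w) ∈ P) :
    IsTModule G t X := by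
  classical
  -- Pairs inside `X` or inside its complement do not affect whether `X` is a module, so only the
  -- crossing pairs are kept.
  let T := S.filter fun e => ∃ v ∈ X, ∃ w, w ∉ X ∧ e = s(v, w)
  refine ⟨T, ?_, ?_⟩
  · calc T.card ≤ (hP.toFinset.image fun p : V × V => s(p.1, p.2)).card := by
          apply Finset.card_le_card
          intro e he
          obtain ⟨heS, v, hv, w, hw, rfl⟩ := Finset.mem_filter.1 he
          exact Finset.mem_image.2 ⟨(v, w), by simpa using hc v hv w hw heS, rfl⟩
      _ ≤ hP.toFinset.card := Finset.card_image_le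
      _ ≤ t := by rwa [← Set.ncard_eq_toFinset_card P hP]
  · have key : ∀ x ∈ X, ∀ z, z ∉ X → ((edit G T).Adj x z ↔ (edit G S).Adj x z) := by
      intro x hx z hz
      have : s(x, z) ∈ T ↔ s(x, z) ∈ S := by
        simp only [T, Finset.mem_filter, and_iff_left_iff_imp]
        exact fun _ => ⟨x, hx, z, hz, rfl⟩
      rw [edit_adj, edit_adj, this]
    intro x hx y hy z hz
    rw [key x hx z hz, key y hy z hz]
    exact hX x hx y hy z hz

/-- In a reduced instance, a module with a neighbour and a non-neighbour outside is independent. -/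
theorem IsReducedInstance.isIndependent {V : Type*} {G : SimpleGraph V} {k : ℕ}
    (hG : IsReducedInstance G k) {M : Set V} (hM : IsModule G M) {v w w' : V} (hv : v ∈ M)
    (hw : w ∉ M) (hw' : w' ∉ M) (h : G.Adj v w) (h' : ¬ G.Adj v w') : IsIndependent G M := by
  by_contra hind
  refine hG.2.2 ⟨M, hM, ?_, hind⟩
  -- The outside neighbour excludes a component of `G`, the outside non-neighbour a component of the
  -- complement.
  rintro ⟨-, ⟨c, rfl⟩ | ⟨c, rfl⟩⟩
  · exact hw ((c.mem_supp_congr_adj h).1 hv)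
  · have : Gᶜ.Adj v w' := by
      rw [SimpleGraph.compl_adj]
      exact ⟨fun e => hw' (e ▸ hv), h'⟩
    exact hw' ((c.mem_supp_congr_adj this).1 hv)

/-! ### Modules below the nodes of a cotree, and edit paths. -/

namespace Cotree

open CographEdit.RootedTree

variable {V N : Type*} {H : SimpleGraph V} (T : Cotree H N)

theorem De_mono {a b : N} (h : T.Anc a b) : T.De b ⊆ T.De a :=
  fun _ hx => h.trans hx

/-- The vertices below a node form a module. -/
theorem isModule_De (u : N) : IsModule H (T.De u) := by
  intro x hx y hy z hz
  obtain ⟨c, hc⟩ := T.exists_isLCA (T.leaf x) (T.leaf z)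
  have above : ∀ {c v}, v ∈ T.De u → T.Anc c (T.leaf v) → T.Anc c (T.leaf z) → T.Anc c u := by
    intro c v hv h1 h2
    rcases Anc.comparable h1 hv with h | h
    · exact h
    · exact absurd (h.trans h2) hz
  have hcu : T.Anc c u := above hx hc.1 hc.2.1
  have hc' : T.IsLCA c (T.leaf y) (T.leaf z) :=
    ⟨hcu.trans hy, hc.2.1, fun b hb hb' => hc.2.2 b ((above hy hb hb').trans hx) hb'⟩
  rw [T.adj_iff x z c (by rintro rfl; exact hz hx) hc,
    T.adj_iff y z c (by rintro rfl; exact hz hy) hc']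

/-- A vertex below `u` is adjacent to a vertex below the parent of `u`, but not below `u`, according
to the label of the parent. -/
theorem adj_iff_label_parent {u : N} {v w : V} (hv : v ∈ T.De (T.parent u)) (hv' : v ∉ T.De u)
    (hw : w ∈ T.De u) : H.Adj v w ↔ T.label (T.parent u) = true := by
  refine T.adj_iff v w _ (by rintro rfl; exact hv' hw) ⟨hv, (anc_parent u).trans hw, ?_⟩
  intro b hb hb'
  rcases Anc.comparable hb' hw with h | h
  · refine h.parent_of_ne ?_
    rintro rfl
    exact hv' hb
  · exact absurd (h.trans hb) hv'

theorem nonempty_De_parent_diff [Finite N] {u : N} (hu : u ≠ T.root) :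
    (T.De (T.parent u) \ T.De u).Nonempty := by
  have hchild : T.IsChild u (T.parent u) := ⟨hu, rfl⟩
  obtain ⟨v, w, hvw, hv, hw⟩ := T.two_children (T.parent u) (fun h => h u hchild)
  obtain ⟨c, hc, hcu⟩ : ∃ c, T.IsChild c (T.parent u) ∧ c ≠ u := by
    by_cases h : v = u
    · exact ⟨w, hw, fun h' => hvw (h.trans h'.symm)⟩
    · exact ⟨v, hv, h⟩
  obtain ⟨l, hl, hcl⟩ := T.exists_leaf_below c
  obtain ⟨x, rfl⟩ : l ∈ Set.range T.leaf := by rw [T.range_leaf]; exact hl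
  refine ⟨x, ?_, fun h => hcu (eq_of_isChild hc hchild hcl h)⟩
  have : T.Anc (T.parent u) c := hc.2 ▸ anc_parent c
  exact this.trans hcl

theorem label_parent_ne {u : N} (hu : u ≠ T.root) (hpu : T.parent u ≠ T.root) :
    T.label (T.parent u) ≠ T.label (T.parent (T.parent u)) :=
  T.label_alternates _ _ ⟨hpu, rfl⟩ (fun h => h u ⟨hu, rfl⟩)

/-- The closest common ancestor of `v` and `w` lies strictly above `u`, so the path from it down to
`v` uses the edge above `u`. This turns pairs of `S` crossing a module into edit paths meeting the
sparse path. -/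
theorem mem_editPathEdges {u : N} {v w : V} (hv : v ∈ T.De u) (hw : w ∉ T.De u) :
    u ∈ T.editPathEdges v w := by
  obtain ⟨z, hz⟩ := T.exists_isLCA (T.leaf v) (T.leaf w)
  refine ⟨z, hz, ?_, ?_, hv⟩
  · rcases Anc.comparable hz.1 hv with h | h
    · exact h
    · exact absurd (h.trans hz.2.1) hw
  · rintro rfl
    exact hw hz.2.1

theorem mem_De_of_mem_editPathEdges {u : N} {v w : V} (h : u ∈ T.editPathEdges v w) :
    v ∈ T.De u ∧ w ∉ T.De u := by
  obtain ⟨z, hz, hzu, hne, huv⟩ := h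
  exact ⟨huv, fun hw => hne ((hz.2.2 u huv hw).antisymm hzu)⟩

end Cotree

/-! ### Chains of modules obtained from sparse paths. -/

/-- An increasing sequence of `q` modules of the edit of `G` by `S`, such that at most `t` ordered
pairs of `S` cross one of them, and the successive differences are alternately joined to and
separated from the preceding modules. -/
structure ModuleChain {V : Type*} (G : SimpleGraph V) (S : Finset (Sym2 V)) (t q : ℕ)
    (D : ℕ → Set V) (L : ℕ → Bool) : Prop where
  mono : Monotone D
  isModule : ∀ i, IsModule (edit G S) (D i)
  nonempty : ∀ i, i + 1 < q → (D (i + 1) \ D i).Nonempty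
  adj_iff : ∀ i, i + 1 < q → ∀ v ∈ D (i + 1) \ D i, ∀ w ∈ D i,
    ((edit G S).Adj v w ↔ L i = true)
  alternates : ∀ i, i + 2 < q → L i ≠ L (i + 1)
  crossing : ∃ P : Set (V × V), P.Finite ∧ P.ncard ≤ t ∧
    ∀ j, j < q → ∀ v ∈ D j, ∀ w, w ∉ D j → s(v, w) ∈ S → (v, w) ∈ P

/-- A sparse path yields a long chain of modules. -/
theorem Cotree.IsSparsePath.exists_moduleChain {V N : Type*} [Finite V] [Finite N]
    {G : SimpleGraph V} {S : Finset (Sym2 V)} {T : Cotree (edit G S) N} {k c : ℕ} {a b : N}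
    (h : T.IsSparsePath S k c a b) :
    ∃ (t q : ℕ) (D : ℕ → Set V) (L : ℕ → Bool), ModuleChain G S t q D L ∧ 0 < t ∧ c * t ≤ q ∧
      k + 2 ≤ (D 0).ncard ∧ ∃ x y, s(x, y) ∈ S ∧ x ∈ D 0 ∧ y ∉ D (q - 1) := by
  classical
  obtain ⟨hab, hne, hforest, ⟨x, y, hxy, hsub⟩, hsparse⟩ := h
  let p : ℕ → N := fun i => T.parent^[i] b
  have hp : ∀ i, p (i + 1) = T.parent (p i) := fun i => Function.iterate_succ_apply' _ _ _
  have hanc : ∀ {i j}, i ≤ j → T.Anc (p j) (p i) := fun {i j} hij =>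
    ⟨j - i, by rw [← Function.iterate_add_apply, Nat.sub_add_cancel hij]⟩
  -- The length of the path: its edges are represented by the nodes `p i` with `i < q`.
  let q := Nat.find hab
  have hq : p q = a := Nat.find_spec hab
  have hlt : ∀ {i}, i < q → p i ≠ a := fun {i} hi => Nat.find_min hab hi
  have hedge : ∀ {i}, i < q → p i ∈ T.descEdges a b := fun {i} hi =>
    ⟨hq ▸ hanc hi.le, hlt hi, ⟨i, rfl⟩⟩
  have hroot : ∀ {i}, i < q → p i ≠ T.root := by
    intro i hi hr
    have h1 : T.Anc a (p i) := (hedge hi).1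
    rw [hr] at h1
    exact hlt hi (hr.trans h1.eq_root.symm)
  have hq0 : 0 < q := by
    rcases Nat.eq_zero_or_pos q with h0 | h0
    · exact absurd (hq.symm.trans (by rw [h0]; rfl)) hne
    · exact h0
  have hcard : (T.descEdges a b).ncard ≤ q := by
    calc (T.descEdges a b).ncard ≤ ((Finset.range q).image p : Set N).ncard := by
          apply Set.ncard_le_ncard _ (Set.toFinite _)
          rintro u ⟨hau, hua, j, rfl⟩
          refine Finset.mem_coe.2 (Finset.mem_image.2 ⟨j, Finset.mem_range.2 ?_, rfl⟩)
          by_contra hj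
          have h1 : T.Anc (p j) a := hq ▸ hanc (not_lt.1 hj)
          exact hua (h1.antisymm hau)
      _ ≤ q := by
          rw [Set.ncard_coe_finset]
          exact Finset.card_image_le.trans (Finset.card_range q).le
  have hP : (T.editPathsMeeting S a b).Finite := Set.toFinite _
  -- The label of `p (i + 1)` governs the adjacency between `D (i + 1) \ D i` and `D i`. The bound
  -- on `D 0` holds because the lower end of the path lies in `T'`.
  refine ⟨(T.editPathsMeeting S a b).ncard, q, fun i => T.De (p i), fun i => T.label (p (i + 1)),
    ?_, ?_, hsparse.trans hcard, (hforest (hedge hq0)).1.2.1, x, y, hxy, ?_, ?_⟩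
  · refine ⟨fun i j hij => T.De_mono (hanc hij), fun i => T.isModule_De _, ?_, ?_, ?_,
      _, hP, le_rfl, ?_⟩
    · intro i hi
      simp only [hp]
      exact T.nonempty_De_parent_diff (hroot (by omega))
    · intro i hi v hv w hw
      simp only [hp] at hv ⊢
      exact T.adj_iff_label_parent hv.1 hv.2 hw
    · intro i hi
      have h1 := T.label_parent_ne (hroot (i := i) (by omega))
        (by rw [← hp]; exact hroot (by omega))
      simpa only [hp] using h1
    · intro j hj v hv w hw hS
      exact ⟨hS, p j, hedge hj, T.mem_editPathEdges hv hw⟩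
  -- The edit path that contains the sparse path is itself counted, hence `t > 0`.
  · exact (Set.ncard_pos hP).2 ⟨(x, y), hxy, p 0, hedge hq0, hsub (hedge hq0)⟩
  · exact (T.mem_De_of_mem_editPathEdges (hsub (hedge hq0))).1
  · exact (T.mem_De_of_mem_editPathEdges (hsub (hedge (by omega : q - 1 < q)))).2

namespace ModuleChain

variable {V : Type*} {G : SimpleGraph V} {S : Finset (Sym2 V)} {t q : ℕ} {D : ℕ → Set V}
  {L : ℕ → Bool}

theorem eq_of_mem (h : ModuleChain G S t q D L) {i j : ℕ} {v : V} (hi : v ∈ D (i + 1) \ D i)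
    (hj : v ∈ D (j + 1) \ D j) : i = j := by
  by_contra hne
  rcases Nat.lt_or_gt_of_ne hne with hlt | hlt
  · exact hj.2 (h.mono hlt hi.1)
  · exact hi.2 (h.mono hlt hj.1)

theorem isTModule (h : ModuleChain G S t q D L) {i : ℕ} (hi : i < q) : IsTModule G t (D i) := by
  obtain ⟨P, hP, ht, hc⟩ := h.crossing
  exact isTModule_of_isModule_edit (h.isModule i) hP ht (hc i hi)

/-- At most `2 * t` of the successive differences of the chain are touched by `S`. -/
theorem card_touched_le (h : ModuleChain G S t q D L) (F : Finset ℕ)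
    (hF : ∀ i ∈ F, i + 1 < q ∧ ¬ Untouched S (D (i + 1) \ D i)) : F.card ≤ 2 * t := by
  classical
  obtain ⟨P, hP, ht, hc⟩ := h.crossing
  -- A pair touching the difference leaves `D i` or `D (i + 1)`; the Boolean records which end lies
  -- in the difference. As the differences are disjoint, pair and end determine `i`.
  have key : ∀ i ∈ F, ∃ e : (V × V) × Bool, e.1 ∈ P ∧
      (if e.2 then e.1.1 else e.1.2) ∈ D (i + 1) \ D i := by
    intro i hi
    obtain ⟨hiq, hu⟩ := hF i hi
    simp only [Untouched, not_forall, not_not] at hu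
    obtain ⟨v, hv, w, hw, hS⟩ := hu
    by_cases hwi : w ∈ D i
    · exact ⟨((w, v), false), hc i (by omega) w hwi v hv.2 (Sym2.eq_swap ▸ hS), by simpa using hv⟩
    · exact ⟨((v, w), true), hc (i + 1) hiq v hv.1 w (fun hw' => hw ⟨hw', hwi⟩) hS,
        by simpa using hv⟩
  rcases F.eq_empty_or_nonempty with rfl | ⟨i₀, hi₀⟩
  · simp
  obtain ⟨e₀, -⟩ := key i₀ hi₀
  have : Nonempty V := ⟨e₀.1.1⟩
  choose! f hf1 hf2 using key
  calc F.card ≤ (hP.toFinset ×ˢ (Finset.univ : Finset Bool)).card := by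
        refine Finset.card_le_card_of_injOn f (fun i hi => ?_) (fun i hi j hj hij => ?_)
        · simpa using hf1 i hi
        · have h1 := hf2 i hi
          rw [hij] at h1
          exact h.eq_of_mem h1 (hf2 j hj)
    _ ≤ 2 * t := by
        rw [Finset.card_product, ← Set.ncard_eq_toFinset_card P hP]
        simp
        omega

theorem label_add_two (h : ModuleChain G S t q D L) {i : ℕ} (hi : i + 3 < q) :
    L (i + 2) = L i := by
  have h1 := h.alternates i (by omega)
  have h2 := h.alternates (i + 1) (by omega)
  revert h1 h2
  show L i ≠ L (i + 1) → L (i + 1) ≠ L (i + 2) → _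
  cases L i <;> cases L (i + 1) <;> cases L (i + 2) <;> simp

theorem label_add_two_mul (h : ModuleChain G S t q D L) {i m : ℕ} (hi : i + 2 * m + 1 < q) :
    L (i + 2 * m) = L i := by
  induction m with
  | zero => rfl
  | succ m ih =>
    rw [← ih (by omega), ← h.label_add_two (i := i + 2 * m) (by omega)]
    rfl

/-- In every long enough window there are two consecutive untouched differences with prescribed
label. -/
theorem exists_untouched (h : ModuleChain G S t q D L) {s : ℕ} (hs : s + 4 * t + 4 < q) :
    ∃ i, s ≤ i ∧ i < s + 4 * t + 2 ∧ L i = true ∧ L (i + 1) = false ∧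
      Untouched S (D (i + 1) \ D i) ∧ Untouched S (D (i + 1 + 1) \ D (i + 1)) := by
  classical
  -- Labels alternate, so a shift by at most one reaches the label `true`.
  obtain ⟨s', hs1, hs2, hL⟩ : ∃ s', s ≤ s' ∧ s' ≤ s + 1 ∧ L s' = true := by
    have h1 := h.alternates s (by omega)
    cases hL : L s with
    | true => exact ⟨s, le_rfl, by omega, hL⟩
    | false => exact ⟨s + 1, by omega, le_rfl, by simpa [hL] using h1.symm⟩
  by_contra hcon
  -- Otherwise `2t + 1` disjoint pairs of consecutive differences would each contain a touched one,
  -- but at most `2t` are touched.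
  have key : ∀ m ∈ Finset.range (2 * t + 1), ∃ j, (j = s' + 2 * m ∨ j = s' + 2 * m + 1) ∧
      ¬ Untouched S (D (j + 1) \ D j) := by
    intro m hm
    have hm' : m < 2 * t + 1 := Finset.mem_range.1 hm
    by_contra hno
    simp only [not_exists, not_and, not_not] at hno
    have hLm : L (s' + 2 * m) = true := by rw [h.label_add_two_mul (by omega), hL]
    refine hcon ⟨s' + 2 * m, by omega, by omega, hLm, ?_, hno _ (Or.inl rfl), hno _ (Or.inr rfl)⟩
    have := h.alternates (s' + 2 * m) (by omega)
    rw [hLm] at this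
    simpa using this.symm
  choose! f hf1 hf2 using key
  have hinj : Set.InjOn f (Finset.range (2 * t + 1) : Set ℕ) := by
    intro m hm m' hm' hmm
    have h1 := hf1 m hm
    have h2 := hf1 m' hm'
    omega
  have hle := h.card_touched_le ((Finset.range (2 * t + 1)).image f) (by
    intro j hj
    obtain ⟨m, hm, rfl⟩ := Finset.mem_image.1 hj
    have h1 := hf1 m hm
    have h2 := Finset.mem_range.1 hm
    exact ⟨by omega, hf2 m hm⟩)
  rw [Finset.card_image_of_injOn hinj, Finset.card_range] at hle
  omega

/-- Many vertices in a long interval of the chain belong to untouched differences with a given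
label. -/
theorem card_untouched [Finite V] (h : ModuleChain G S t q D L) {i j : ℕ}
    (hij : i + 10 * t + 1 ≤ j) (hj : j < q) {Z : Set V}
    (hZ : ∀ l, i ≤ l → l < j → L l = L i → Untouched S (D (l + 1) \ D l) →
      D (l + 1) \ D l ⊆ Z) : 3 * t + 1 ≤ Z.ncard := by
  classical
  -- Every second index, from `i` to `i + 10t`, has the label of `i`. Of these `5t + 1` differences
  -- at most `2t` are touched, and each of the others contributes a vertex of `Z`.
  let R := (Finset.range (5 * t + 1)).image fun m => i + 2 * m
  have hR : R.card = 5 * t + 1 := by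
    rw [Finset.card_image_of_injective _ (fun a b hab => by simpa using hab), Finset.card_range]
  have hRm : ∀ l ∈ R, i ≤ l ∧ l < j ∧ L l = L i := by
    intro l hl
    obtain ⟨m, hm, rfl⟩ := Finset.mem_image.1 hl
    have := Finset.mem_range.1 hm
    exact ⟨by omega, by omega, h.label_add_two_mul (by omega)⟩
  let F := R.filter fun l => Untouched S (D (l + 1) \ D l)
  let F' := R.filter fun l => ¬ Untouched S (D (l + 1) \ D l)
  have hsum : F.card + F'.card = 5 * t + 1 := by
    rw [← hR]
    exact Finset.card_filter_add_card_filter_not _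
  have hF' : F'.card ≤ 2 * t := h.card_touched_le F' (by
    intro l hl
    obtain ⟨hl, hu⟩ := Finset.mem_filter.1 hl
    have := hRm l hl
    exact ⟨by omega, hu⟩)
  have hex : ∀ l ∈ F, ∃ v, v ∈ D (l + 1) \ D l := by
    intro l hl
    have := hRm l (Finset.mem_filter.1 hl).1
    exact h.nonempty l (by omega)
  have : Nonempty V := let ⟨v, _⟩ := h.nonempty i (by omega); ⟨v⟩
  choose! f hf using hex
  have hinj : Set.InjOn f (F : Set ℕ) := by
    intro l hl l' hl' hll
    have h1 := hf l hl
    rw [hll] at h1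
    exact h.eq_of_mem h1 (hf l' hl')
  have hle : F.card ≤ Z.ncard := by
    rw [← Finset.card_image_of_injOn hinj, ← Set.ncard_coe_finset]
    refine Set.ncard_le_ncard ?_ (Set.toFinite _)
    intro v hv
    obtain ⟨l, hl, rfl⟩ := Finset.mem_image.1 (Finset.mem_coe.1 hv)
    obtain ⟨hl', hu⟩ := Finset.mem_filter.1 hl
    obtain ⟨h1, h2, h3⟩ := hRm l hl'
    exact hZ l h1 h2 h3 hu (hf l hl)
  omega

theorem le_ncard [Finite V] (h : ModuleChain G S t q D L) {i : ℕ} (hi : i < q) :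
    (D 0).ncard + i ≤ (D i).ncard := by
  induction i with
  | zero => rfl
  | succ i ih =>
    have h1 := ih (by omega)
    obtain ⟨v, hv⟩ := h.nonempty i hi
    have h2 : (D i).ncard < (D (i + 1)).ncard :=
      Set.ncard_lt_ncard ⟨h.mono (Nat.le_succ i), fun h' => hv.2 (h' hv.1)⟩ (Set.toFinite _)
    omega

/-- Adjacency in `G` of a vertex of an untouched difference to a vertex of an earlier module. -/
theorem adj_iff_of_untouched (h : ModuleChain G S t q D L) {i : ℕ} (hi : i + 1 < q)
    (hu : Untouched S (D (i + 1) \ D i)) {v w : V} (hv : v ∈ D (i + 1) \ D i) (hw : w ∈ D i) :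
    G.Adj v w ↔ L i = true := by
  rw [hu.adj_iff hv (fun h' => h'.2 hw), h.adj_iff i hi v hv w hw]

/-- Vertices of untouched differences in `D j` have the same neighbours in `G` outside `D j`. -/
theorem adj_congr (h : ModuleChain G S t q D L) {i i' j : ℕ} (hij : i + 1 ≤ j) (hij' : i' + 1 ≤ j)
    (hu : Untouched S (D (i + 1) \ D i)) (hu' : Untouched S (D (i' + 1) \ D i')) {v v' w : V}
    (hv : v ∈ D (i + 1) \ D i) (hv' : v' ∈ D (i' + 1) \ D i') (hw : w ∉ D j) :
    G.Adj v w ↔ G.Adj v' w := by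
  rw [hu.adj_iff hv (fun h' => hw (h.mono hij h'.1)),
    hu'.adj_iff hv' (fun h' => hw (h.mono hij' h'.1))]
  exact h.isModule j v (h.mono hij hv.1) v' (h.mono hij' hv'.1) w hw

theorem isModule_diff (h : ModuleChain G S t q D L) {i : ℕ} (hi : i + 1 < q) :
    IsModule (edit G S) (D (i + 1) \ D i) := by
  intro x hx y hy z hz
  by_cases hzi : z ∈ D i
  · rw [h.adj_iff i hi x hx z hzi, h.adj_iff i hi y hy z hzi]
  · exact h.isModule (i + 1) x hx.1 y hy.1 z (fun h' => hz ⟨h', hzi⟩)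

/-- Untouched differences are independent in a reduced instance. -/
theorem isIndependent_diff (h : ModuleChain G S t q D L) {k : ℕ} (hG : IsReducedInstance G k)
    (h0 : (D 0).Nonempty) {i : ℕ} (hi : i + 2 < q) (hu : Untouched S (D (i + 1) \ D i)) :
    IsIndependent G (D (i + 1) \ D i) := by
  obtain ⟨w, hw⟩ := h0
  have hwi : w ∈ D i := h.mono (Nat.zero_le i) hw
  obtain ⟨v, hv⟩ := h.nonempty i (by omega)
  -- Since labels alternate, one of `w` (below) and `w'` (in the next difference) is a neighbour of
  -- `v` and the other is not.
  obtain ⟨w', hw'⟩ := h.nonempty (i + 1) (by omega)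
  have hn : w ∉ D (i + 1) \ D i := fun h' => h'.2 hwi
  have hn' : w' ∉ D (i + 1) \ D i := fun h' => hw'.2 h'.1
  have h1 : G.Adj v w ↔ L i = true := h.adj_iff_of_untouched (by omega) hu hv hwi
  have h2 : G.Adj v w' ↔ L (i + 1) = true := by
    rw [hu.adj_iff hv hn', SimpleGraph.adj_comm]
    exact h.adj_iff (i + 1) (by omega) w' hw' v hv.1
  have hM : IsModule G (D (i + 1) \ D i) := hu.isModule (h.isModule_diff (by omega))
  have halt := h.alternates i hi
  cases hL : L i with
  | true =>
    have hL' : L (i + 1) = false := by simpa [hL] using halt.symm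
    exact hG.isIndependent hM hv hn hn' (h1.2 hL) (by simp [h2, hL'])
  | false =>
    have hL' : L (i + 1) = true := by simpa [hL] using halt.symm
    exact hG.isIndependent hM hv hn' hn (h2.2 hL') (by simp [h1, hL])

/-- Two vertices in consecutive untouched differences distinguish exactly the preceding module. -/
theorem distinguishers_eq (h : ModuleChain G S t q D L) {k : ℕ} (hG : IsReducedInstance G k)
    (h0 : (D 0).Nonempty) {i : ℕ} (hi : i + 3 < q) (hL : L i = true) (hL' : L (i + 1) = false)
    (hu : Untouched S (D (i + 1) \ D i)) (hu' : Untouched S (D (i + 1 + 1) \ D (i + 1)))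
    {x x' : V} (hx : x ∈ D (i + 1) \ D i) (hx' : x' ∈ D (i + 1 + 1) \ D (i + 1)) :
    distinguishers G x x' = D i := by
  have hlow : ∀ {a}, a ∈ D (i + 1) → ¬ G.Adj a x' := by
    intro a ha
    rw [SimpleGraph.adj_comm, h.adj_iff_of_untouched (by omega) hu' hx' ha, hL']
    simp
  ext a
  show Xor (G.Adj a x) (G.Adj a x') ↔ _
  by_cases h1 : a ∈ D i
  · have h2 : ¬ G.Adj a x' := hlow (h.mono (Nat.le_succ i) h1)
    have h3 : G.Adj a x := by
      rw [SimpleGraph.adj_comm, h.adj_iff_of_untouched (by omega) hu hx h1, hL]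
    simp [h1, h2, h3]
  -- Outside `D i`: vertices of the two differences are adjacent to neither `x` nor `x'`, by
  -- independence and the label `false` of the upper one; vertices further out see both alike.
  · have key : ¬ Xor (G.Adj a x) (G.Adj a x') := by
      by_cases h2 : a ∈ D (i + 1)
      · have h3 : ¬ G.Adj a x := h.isIndependent_diff hG h0 (by omega) hu a ⟨h2, h1⟩ x hx
        simp [h3, hlow h2]
      · by_cases h4 : a ∈ D (i + 1 + 1)
        · have h5 : ¬ G.Adj a x' := h.isIndependent_diff hG h0 (by omega) hu' a ⟨h4, h2⟩ x' hx'
          have h6 : ¬ G.Adj a x := by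
            rw [SimpleGraph.adj_comm, hu.adj_iff hx (fun h' => h2 h'.1), SimpleGraph.adj_comm,
              h.adj_iff (i + 1) (by omega) a ⟨h4, h2⟩ x hx.1, hL']
            simp
          simp [h5, h6]
        · have h7 := h.adj_congr (j := i + 1 + 1) (Nat.le_succ _) le_rfl hu hu' hx hx' h4
          rw [SimpleGraph.adj_comm, SimpleGraph.adj_comm _ x'] at h7
          simp [h7]
    simp [h1, key]

/-- The sets are `A = D i₁`, `A ∪ B = D i₂` and `A ∪ B ∪ C = D i₃`. The worst-case positions satisfy
`i₃ ≤ 33t + 7`, and the windows end before `33t + 10 < 51t ≤ q`. -/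
theorem exists_nestedRuleApplies [Finite V] (h : ModuleChain G S t q D L) {k : ℕ}
    (hG : IsReducedInstance G k) (ht : 0 < t) (hq : 51 * t ≤ q) (hk : k + 2 ≤ (D 0).ncard)
    {a₀ b₀ : V} (hS : s(a₀, b₀) ∈ S) (ha₀ : a₀ ∈ D 0) (hb₀ : b₀ ∉ D (q - 1)) :
    ∃ (A B C K I : Set V), NestedRuleApplies G k t A B C K I ∧
        ∃ x x' y y' z z' : V, DeterminedBy G x x' y y' z z' A B C K I := by
  have h0 : (D 0).Nonempty := ⟨a₀, ha₀⟩
  -- Starting at level `t` gives `|A| ≥ k + 2 + t`, since every level adds a vertex.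
  obtain ⟨i₁, hi₁, hi₁', hL₁, hL₁', hu₁, hv₁⟩ := h.exists_untouched (s := t) (by omega)
  obtain ⟨i₂, hi₂, hi₂', hL₂, hL₂', hu₂, hv₂⟩ :=
    h.exists_untouched (s := i₁ + 10 * t + 2) (by omega)
  obtain ⟨i₃, hi₃, hi₃', hL₃, hL₃', hu₃, hv₃⟩ :=
    h.exists_untouched (s := i₂ + 10 * t + 2) (by omega)
  obtain ⟨x, hx⟩ := h.nonempty i₁ (by omega)
  obtain ⟨x', hx'⟩ := h.nonempty (i₁ + 1) (by omega)
  obtain ⟨y, hy⟩ := h.nonempty i₂ (by omega)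
  obtain ⟨y', hy'⟩ := h.nonempty (i₂ + 1) (by omega)
  obtain ⟨z, hz⟩ := h.nonempty i₃ (by omega)
  obtain ⟨z', hz'⟩ := h.nonempty (i₃ + 1) (by omega)
  have hA := h.distinguishers_eq hG h0 (by omega) hL₁ hL₁' hu₁ hv₁ hx hx'
  have hB := h.distinguishers_eq hG h0 (by omega) hL₂ hL₂' hu₂ hv₂ hy hy'
  have hC := h.distinguishers_eq hG h0 (by omega) hL₃ hL₃' hu₃ hv₃ hz hz'
  have h12 : D i₁ ⊆ D i₂ := h.mono (by omega)
  have h23 : D i₂ ⊆ D i₃ := h.mono (by omega)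
  have hAB : D i₁ ∪ (D i₂ \ D i₁) = D i₂ := Set.union_sdiff_cancel h12
  have hABC : D i₂ ∪ (D i₃ \ D i₂) = D i₃ := Set.union_sdiff_cancel h23
  let K : Set V := {s | s ∉ D i₃ ∧ G.Adj s x}
  let I : Set V := {s | s ∉ D i₃ ∧ ¬ G.Adj s x}
  have hadjx : ∀ {l v w}, l + 1 ≤ i₃ → Untouched S (D (l + 1) \ D l) → v ∈ D (l + 1) \ D l →
      w ∉ D i₃ → (G.Adj v w ↔ G.Adj w x) := by
    intro l v w hl hu hv hw
    rw [G.adj_comm w x]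
    exact h.adj_congr hl (by omega) hu hu₁ hv hx hw
  -- Counting joined vertices starts at `i`, counting separated ones at `i + 1`; the gap `10t + 2`
  -- leaves `10t + 1` levels in both cases.
  have hjoin : ∀ {i j}, i + 10 * t + 2 ≤ j → j ≤ i₃ → L i = true →
      3 * t + 1 ≤ (joinedPart G (D j \ D i) (D i) K I).ncard := by
    intro i j hij hj hL
    refine h.card_untouched (i := i) (j := j) (by omega) (by omega) ?_
    intro l hil hlj hl hu v hv
    refine ⟨⟨h.mono hlj hv.1, fun h' => hv.2 (h.mono hil h')⟩, ?_, ?_, ?_⟩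
    · intro a ha
      rw [h.adj_iff_of_untouched (by omega) hu hv (h.mono hil ha), hl, hL]
    · exact fun c hc => (hadjx (by omega) hu hv hc.1).2 hc.2
    · exact fun c hc hvc => hc.2 ((hadjx (by omega) hu hv hc.1).1 hvc)
  have hsep : ∀ {i j}, i + 10 * t + 2 ≤ j → j ≤ i₃ → L (i + 1) = false →
      3 * t + 1 ≤ (separatedPart G (D j \ D i) (D i) K I).ncard := by
    intro i j hij hj hL
    refine h.card_untouched (i := i + 1) (j := j) (by omega) (by omega) ?_
    intro l hil hlj hl hu v hv
    have hil' : i ≤ l := by omega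
    refine ⟨⟨h.mono hlj hv.1, fun h' => hv.2 (h.mono hil' h')⟩, ?_, ?_, ?_⟩
    · intro a ha
      rw [h.adj_iff_of_untouched (by omega) hu hv (h.mono hil' ha), hl, hL]
      simp
    · exact fun c hc => (hadjx (by omega) hu hv hc.1).2 hc.2
    · exact fun c hc hvc => hc.2 ((hadjx (by omega) hu hv hc.1).1 hvc)
  have hxi₃ : x ∈ D i₃ := h.mono (by omega : i₁ + 1 ≤ i₃) hx.1
  have hzK : z ∈ K := by
    refine ⟨hz.2, ?_⟩
    rw [h.adj_iff_of_untouched (by omega) hu₃ hz hxi₃, hL₃]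
  have hzI : z' ∈ I := by
    refine ⟨fun h' => hz'.2 (h.mono (Nat.le_succ _) h'), ?_⟩
    rw [h.adj_iff_of_untouched (by omega) hv₃ hz' (h.mono (Nat.le_succ _) hxi₃), hL₃']
    simp
  have hBne : (D i₂ \ D i₁).Nonempty := by
    obtain ⟨v, hv⟩ := h.nonempty i₁ (by omega)
    exact ⟨v, h.mono (by omega : i₁ + 1 ≤ i₂) hv.1, hv.2⟩
  have hCne : (D i₃ \ D i₂).Nonempty := by
    obtain ⟨v, hv⟩ := h.nonempty i₂ (by omega)
    exact ⟨v, h.mono (by omega : i₂ + 1 ≤ i₃) hv.1, hv.2⟩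
  have haA : a₀ ∈ D i₁ := h.mono (Nat.zero_le _) ha₀
  have hb₃ : b₀ ∉ D i₃ := fun h' => hb₀ (h.mono (by omega) h')
  have hne : a₀ ≠ b₀ := by
    rintro rfl
    exact hb₃ (h23 (h12 haA))
  refine ⟨D i₁, D i₂ \ D i₁, D i₃ \ D i₂, K, I, ⟨?_, ?_⟩, x, x', y, y', z, z', ?_⟩
  · refine ⟨⟨⟨a₀, haA⟩, hBne, hCne, ⟨z, hzK⟩, ⟨z', hzI⟩⟩, ?_, ?_, ?_, ?_, ?_, ?_, ?_, ?_, ?_, ?_⟩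
    · rw [hAB, hABC]
      ext v
      by_cases h1 : v ∈ D i₃ <;> by_cases h2 : G.Adj v x <;> simp [K, I, h1, h2]
    · have h13 := h12.trans h23
      simp only [List.pairwise_cons, List.mem_cons, List.not_mem_nil, or_false, forall_eq_or_imp,
        forall_eq, Set.disjoint_left, K, I, Set.mem_sdiff, Set.mem_ofPred_eq]
      refine ⟨⟨?_, ?_, ?_, ?_⟩, ⟨?_, ?_, ?_⟩, ⟨?_, ?_⟩, ?_, ?_⟩ <;> grind
    · exact h.isTModule (by omega)
    · rw [hAB]; exact h.isTModule (by omega)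
    · rw [hAB, hABC]; exact h.isTModule (by omega)
    · have := h.le_ncard (i := i₁) (by omega)
      omega
    · exact hjoin hi₂ (by omega) hL₁
    · exact hsep hi₂ (by omega) hL₁'
    · rw [hAB]; exact hjoin hi₃ le_rfl hL₂
    · rw [hAB]; exact hsep hi₃ le_rfl hL₂'
  -- The pair `a₀b₀` is edited while `xb₀` is not, and both have the same status in `H`; so `a₀` and
  -- `x` disagree on `b₀` in `G`, and `x` decides whether `b₀` is in `K` or in `I`.
  · have hedit := edit_adj_of_mem G hS hne
    have hmod := h.isModule i₃ a₀ (h23 (h12 haA)) x hxi₃ b₀ hb₃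
    have hxb : G.Adj x b₀ ↔ (edit G S).Adj x b₀ :=
      hu₁.adj_iff hx (fun h' => hb₃ (h.mono (by omega : i₁ + 1 ≤ i₃) h'.1))
    by_cases hb : G.Adj b₀ x
    · right
      refine ⟨a₀, haA, b₀, ⟨hb₃, hb⟩, hedit.1 (hmod.2 (hxb.1 hb.symm))⟩
    · left
      refine ⟨a₀, haA, b₀, ⟨hb₃, hb⟩, ?_⟩
      by_contra hab
      exact hb (hxb.2 (hmod.1 (hedit.2 hab))).symm
  · refine ⟨hA.symm, by rw [hB], ?_, ?_, ?_⟩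
    · rw [hC, hAB]
    · rw [hAB, hABC]
    · rw [hAB, hABC]

end ModuleChain

theorem exists_nestedRuleApplies_of_isSparsePath {V N : Type*} [Finite V] [Finite N]
    {G : SimpleGraph V} {k : ℕ} {S : Finset (Sym2 V)} {T : Cotree (edit G S) N}
    (hG : IsReducedInstance G k) {a b : N} (h : T.IsSparsePath S k 51 a b) :
    ∃ (t : ℕ) (A B C K I : Set V), NestedRuleApplies G k t A B C K I ∧
      ∃ x x' y y' z z' : V, DeterminedBy G x x' y y' z z' A B C K I := by
  obtain ⟨t, q, D, L, hD, ht, hq, hk, x, y, hS, hx, hy⟩ := h.exists_moduleChain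
  exact ⟨t, hD.exists_nestedRuleApplies hG ht hq hk hS hx hy⟩

/-! ## Total correctness of programs -/

/-- Started in `s`, the program `p` halts within `B` steps in a state that satisfies `Q`. -/
def Runs {n : ℕ} (G : SimpleGraph (Fin n)) (p : Program) (s : State) (B : ℕ) (Q : State → Prop) :
    Prop :=
  ∃ τ s', Exec G p s τ s' ∧ τ ≤ B ∧ Q s'

section Runs

variable {n : ℕ} {G : SimpleGraph (Fin n)} {p q : Program} {s : State} {B B' : ℕ}
  {Q Q' : State → Prop}

theorem Runs.mono (h : Runs G p s B Q) (hB : B ≤ B') (hQ : ∀ s', Q s' → Q' s') :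
    Runs G p s B' Q' := by
  obtain ⟨τ, s', h1, h2, h3⟩ := h
  exact ⟨τ, s', h1, h2.trans hB, hQ s' h3⟩

theorem Runs.seq (h : Runs G p s B Q) (h' : ∀ s', Q s' → Runs G q s' B' Q') :
    Runs G (.seq p q) s (B + B') Q' := by
  obtain ⟨τ, s', h1, h2, h3⟩ := h
  obtain ⟨τ', s'', h1', h2', h3'⟩ := h' s' h3
  exact ⟨τ + τ', s'', .seq h1 h1', by omega, h3'⟩

theorem Runs.const {r c : ℕ} (h : Q (s.setReg r c)) : Runs G (.const r c) s 1 Q :=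
  ⟨1, _, .const r c s, le_rfl, h⟩

theorem Runs.add {r a b : ℕ} (h : Q (s.setReg r (s.reg a + s.reg b))) :
    Runs G (.add r a b) s 1 Q :=
  ⟨1, _, .add r a b s, le_rfl, h⟩

theorem Runs.sub {r a b : ℕ} (h : Q (s.setReg r (s.reg a - s.reg b))) :
    Runs G (.sub r a b) s 1 Q :=
  ⟨1, _, .sub r a b s, le_rfl, h⟩

theorem Runs.store {a r : ℕ} (h : Q (s.setMem (s.reg a) (s.reg r))) :
    Runs G (.store a r) s 1 Q :=
  ⟨1, _, .store a r s, le_rfl, h⟩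

theorem Runs.const_seq {r c : ℕ} (h : Runs G q (s.setReg r c) B Q) :
    Runs G (.seq (.const r c) q) s (1 + B) Q :=
  Runs.seq (Runs.const (Q := fun s' => s' = s.setReg r c) rfl) (by rintro _ rfl; exact h)

theorem Runs.add_seq {r a b : ℕ} (h : Runs G q (s.setReg r (s.reg a + s.reg b)) B Q) :
    Runs G (.seq (.add r a b) q) s (1 + B) Q :=
  Runs.seq (Runs.add (Q := fun s' => s' = s.setReg r (s.reg a + s.reg b)) rfl)
    (by rintro _ rfl; exact h)

theorem Runs.sub_seq {r a b : ℕ} (h : Runs G q (s.setReg r (s.reg a - s.reg b)) B Q) :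
    Runs G (.seq (.sub r a b) q) s (1 + B) Q :=
  Runs.seq (Runs.sub (Q := fun s' => s' = s.setReg r (s.reg a - s.reg b)) rfl)
    (by rintro _ rfl; exact h)

theorem Runs.ite {r : ℕ} (h : s.reg r ≠ 0 → Runs G p s B Q) (h' : s.reg r = 0 → Runs G q s B' Q) :
    Runs G (.ite r p q) s (B + B' + 1) Q := by
  by_cases hr : s.reg r = 0
  · obtain ⟨τ, s', h1, h2, h3⟩ := h' hr
    exact ⟨τ + 1, s', .ite_false hr h1, by omega, h3⟩
  · obtain ⟨τ, s', h1, h2, h3⟩ := h hr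
    exact ⟨τ + 1, s', .ite_true hr h1, by omega, h3⟩

/-- A loop whose body lowers the register `r` by one. -/
theorem Runs.while {r : ℕ} (Inv : ℕ → State → Prop) (hr : ∀ j s, Inv j s → s.reg r = j)
    (hbody : ∀ j s, Inv (j + 1) s → Runs G p s B (Inv j)) (m : ℕ) :
    ∀ s, Inv m s → Runs G (.while r p) s (m * (B + 1) + 1) (Inv 0) := by
  induction m with
  | zero => exact fun s hs => ⟨1, s, .while_false (hr 0 s hs), by omega, hs⟩
  | succ m ih =>
    intro s hs
    obtain ⟨τ, s', h1, h2, h3⟩ := hbody m s hs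
    obtain ⟨τ', s'', h1', h2', h3'⟩ := ih s' h3
    refine ⟨τ + τ' + 1, s'', .while_true ?_ h1 h1', ?_, h3'⟩
    · rw [hr _ s hs]
      exact Nat.succ_ne_zero m
    · rw [Nat.succ_mul]
      omega

end Runs

@[simp] theorem State.setReg_reg (s : State) (r v j : ℕ) :
    (s.setReg r v).reg j = if j = r then v else s.reg j := by
  simp [State.setReg, Function.update_apply]

@[simp] theorem State.setReg_mem (s : State) (r v : ℕ) : (s.setReg r v).mem = s.mem := rfl

@[simp] theorem State.setMem_reg (s : State) (a v : ℕ) : (s.setMem a v).reg = s.reg := rfl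

@[simp] theorem State.setMem_mem (s : State) (a v j : ℕ) :
    (s.setMem a v).mem j = if j = a then v else s.mem j := by
  simp [State.setMem, Function.update_apply]

/-! ## Expressions with bounded sums -/

/-- Expressions over an input graph with `n` vertices; `sum i e` is the sum of `e` over all values
of the variable `i` below `n`. -/
inductive CountExpr
  | var (i : ℕ)
  | const (c : ℕ)
  | add (a b : CountExpr)
  | sub (a b : CountExpr)
  | adj (a b : CountExpr)
  | ite (c a b : CountExpr)
  | sum (i : ℕ) (e : CountExpr)

namespace CountExpr

/-- The value of an expression. -/
noncomputable def eval {n : ℕ} (G : SimpleGraph (Fin n)) : CountExpr → (ℕ → ℕ) → ℕ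
  | var i, env => env i
  | const c, _ => c
  | add a b, env => a.eval G env + b.eval G env
  | sub a b, env => a.eval G env - b.eval G env
  | adj a b, env => adjEntry G (a.eval G env) (b.eval G env)
  | ite c a b, env => if c.eval G env ≠ 0 then a.eval G env else b.eval G env
  | sum i e, env => ∑ v ∈ Finset.range n, e.eval G (Function.update env i v)

/-- The program that computes an expression. The variable `i` is kept in register `2 * i + 2`, the
result goes to register `2 * d + 1`, and only odd registers from there on are overwritten. -/
def compile : CountExpr → ℕ → Program
  | var i, d => .seq (.const (2 * d + 3) 0) (.add (2 * d + 1) (2 * i + 2) (2 * d + 3))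
  | const c, d => .const (2 * d + 1) c
  | add a b, d =>
    .seq (a.compile d) (.seq (b.compile (d + 1)) (.add (2 * d + 1) (2 * d + 1) (2 * d + 3)))
  | sub a b, d =>
    .seq (a.compile d) (.seq (b.compile (d + 1)) (.sub (2 * d + 1) (2 * d + 1) (2 * d + 3)))
  | adj a b, d =>
    .seq (a.compile d) (.seq (b.compile (d + 1)) (.query (2 * d + 1) (2 * d + 1) (2 * d + 3)))
  | ite c a b, d => .seq (c.compile d) (.ite (2 * d + 1) (a.compile d) (b.compile d))
  | sum i e, d =>
    .seq (.const (2 * d + 1) 0)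
    (.seq (.add (2 * d + 3) (2 * i + 2) (2 * d + 1))
    (.seq (.add (2 * i + 2) 0 (2 * d + 1))
    (.seq (.while (2 * i + 2)
      (.seq (.const (2 * d + 5) 1)
      (.seq (.sub (2 * i + 2) (2 * i + 2) (2 * d + 5))
      (.seq (e.compile (d + 2)) (.add (2 * d + 1) (2 * d + 1) (2 * d + 5))))))
    (.seq (.const (2 * d + 5) 0) (.add (2 * i + 2) (2 * d + 3) (2 * d + 5))))))

/-- A bound for the number of steps of the program that computes an expression. -/
def cost (n : ℕ) : CountExpr → ℕ
  | var _ => 2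
  | const _ => 1
  | add a b => a.cost n + (b.cost n + 1)
  | sub a b => a.cost n + (b.cost n + 1)
  | adj a b => a.cost n + (b.cost n + 1)
  | ite c a b => c.cost n + (a.cost n + b.cost n + 1)
  | sum _ e => 1 + (1 + (1 + ((n * ((1 + (1 + (e.cost n + 1))) + 1) + 1) + (1 + 1))))

/-- Each `sum` multiplies the cost by about `n`, so the degree depends only on the expression and
not on the input. -/
theorem exists_cost_le (e : CountExpr) : ∃ c d, ∀ n, e.cost n ≤ c * (n + 1) ^ d := by
  have key : ∀ {c c' d d' n : ℕ}, c * (n + 1) ^ d + c' * (n + 1) ^ d' + 1 ≤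
      (c + c' + 1) * (n + 1) ^ (d + d') := by
    intro c c' d d' n
    have h1 : (n + 1) ^ d ≤ (n + 1) ^ (d + d') := Nat.pow_le_pow_right (by omega) (by omega)
    have h2 : (n + 1) ^ d' ≤ (n + 1) ^ (d + d') := Nat.pow_le_pow_right (by omega) (by omega)
    have h3 : 1 ≤ (n + 1) ^ (d + d') := Nat.one_le_pow _ _ (by omega)
    have h4 := Nat.mul_le_mul_left c h1
    have h5 := Nat.mul_le_mul_left c' h2
    rw [add_mul, add_mul]
    omega
  have bin : ∀ {f g : ℕ → ℕ}, (∃ c d, ∀ n, f n ≤ c * (n + 1) ^ d) →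
      (∃ c d, ∀ n, g n ≤ c * (n + 1) ^ d) → ∃ c d, ∀ n, f n + g n + 1 ≤ c * (n + 1) ^ d := by
    rintro f g ⟨c, d, h⟩ ⟨c', d', h'⟩
    refine ⟨c + c' + 1, d + d', fun n => le_trans ?_ key⟩
    have := h n
    have := h' n
    omega
  induction e with
  | var i => exact ⟨2, 0, fun n => by simp [cost]⟩
  | const c => exact ⟨1, 0, fun n => by simp [cost]⟩
  | add a b ha hb => exact bin ha hb
  | sub a b ha hb => exact bin ha hb
  | adj a b ha hb => exact bin ha hb
  | ite c a b hc ha hb =>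
    obtain ⟨k, d, h⟩ := bin hc (bin ha hb)
    refine ⟨k, d, fun n => le_trans ?_ (h n)⟩
    simp only [cost]
    omega
  | sum i e he =>
    obtain ⟨c, d, h⟩ := he
    refine ⟨c + 10, d + 1, fun n => ?_⟩
    have h1 := Nat.mul_le_mul_left n (h n)
    have h2 : 1 ≤ (n + 1) ^ d := Nat.one_le_pow _ _ (by omega)
    have h3 : n * 1 ≤ n * (n + 1) ^ d := Nat.mul_le_mul_left n h2
    have h4 : (c + 10) * (n + 1) ^ (d + 1) = n * (c * (n + 1) ^ d) + c * (n + 1) ^ d +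
      10 * (n * (n + 1) ^ d) + 10 * (n + 1) ^ d := by ring
    have h5 : n * ((1 + (1 + (e.cost n + 1))) + 1) = n * e.cost n + 4 * n := by ring
    simp only [cost]
    rw [h4, h5]
    omega

/-- The values of the variables in a state. -/
def envOf (s : State) : ℕ → ℕ := fun i => s.reg (2 * i + 2)

/-- `s'` differs from `s` at most in the odd registers from `2 * d + 1` on. -/
def Frame (d : ℕ) (s s' : State) : Prop :=
  s'.mem = s.mem ∧ ∀ r, r % 2 = 0 ∨ r < 2 * d + 1 → s'.reg r = s.reg r

theorem Frame.envOf_eq {d : ℕ} {s s' : State} (h : Frame d s s') : envOf s' = envOf s :=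
  funext fun i => h.2 _ (Or.inl (by omega))

theorem Frame.trans_of_le {d d' : ℕ} {s s' s'' : State} (h : Frame d s s') (h' : Frame d' s' s'')
    (hd : d ≤ d') : Frame d s s'' :=
  ⟨h'.1.trans h.1, fun r hr => (h'.2 r (by omega)).trans (h.2 r hr)⟩

theorem Frame.setReg (d : ℕ) (s : State) (v : ℕ) : Frame d s (s.setReg (2 * d + 1) v) := by
  refine ⟨rfl, fun r hr => ?_⟩
  rw [State.setReg_reg, if_neg (by omega)]

/-- Evaluation of two expressions, followed by an operation. -/
theorem runs_binary {n : ℕ} {G : SimpleGraph (Fin n)} {a b : CountExpr} {op : Program}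
    {f : ℕ → ℕ → ℕ} {d : ℕ}
    (hop : ∀ s : State, Exec G op s 1
      (s.setReg (2 * d + 1) (f (s.reg (2 * d + 1)) (s.reg (2 * d + 3)))))
    (ha : ∀ d (s : State), s.reg 0 = n → Runs G (a.compile d) s (a.cost n) fun s' =>
      s'.reg (2 * d + 1) = a.eval G (envOf s) ∧ Frame d s s')
    (hb : ∀ d (s : State), s.reg 0 = n → Runs G (b.compile d) s (b.cost n) fun s' =>
      s'.reg (2 * d + 1) = b.eval G (envOf s) ∧ Frame d s s')
    (s : State) (hs : s.reg 0 = n) :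
    Runs G (.seq (a.compile d) (.seq (b.compile (d + 1)) op)) s (a.cost n + (b.cost n + 1))
      fun s' => s'.reg (2 * d + 1) = f (a.eval G (envOf s)) (b.eval G (envOf s)) ∧
        Frame d s s' := by
  refine (ha d s hs).seq fun s₁ ⟨h1, h2⟩ => ?_
  refine (hb (d + 1) s₁ ((h2.2 0 (by omega)).trans hs)).seq fun s₂ ⟨h3, h4⟩ => ?_
  refine ⟨1, _, hop s₂, le_rfl, ?_, ?_⟩
  · rw [State.setReg_reg, if_pos rfl, h4.2 _ (by omega), h1, ← h2.envOf_eq, ← h3]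
    rfl
  · exact (h2.trans_of_le h4 (by omega)).trans_of_le (Frame.setReg d s₂ _) le_rfl

/-- The frame condition carries the induction: compiling the second operand one level deeper
preserves the first result, and even registers, which hold `n` and the variables, end unchanged. -/
theorem runs_compile {n : ℕ} (G : SimpleGraph (Fin n)) (e : CountExpr) :
    ∀ d (s : State), s.reg 0 = n → Runs G (e.compile d) s (e.cost n) fun s' =>
      s'.reg (2 * d + 1) = e.eval G (envOf s) ∧ Frame d s s' := by
  induction e with
  | var i =>
    intro d s hs
    refine Runs.const_seq (Runs.add ⟨?_, rfl, fun r hr => ?_⟩)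
    · simp [eval, envOf]
      omega
    · rw [State.setReg_reg, if_neg (by omega), State.setReg_reg, if_neg (by omega)]
  | const c =>
    intro d s hs
    exact Runs.const ⟨by simp [eval], Frame.setReg d s c⟩
  | add a b ha hb => exact fun d => runs_binary (f := fun x y => x + y) (fun s => .add _ _ _ s) ha hb
  | sub a b ha hb => exact fun d => runs_binary (f := fun x y => x - y) (fun s => .sub _ _ _ s) ha hb
  | adj a b ha hb =>
    exact fun d => runs_binary (f := fun x y => adjEntry G x y) (fun s => .query _ _ _ s) ha hb
  | ite c a b hc ha hb =>
    intro d s hs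
    refine (hc d s hs).seq fun s₁ ⟨h1, h2⟩ => ?_
    have hs₁ : s₁.reg 0 = n := (h2.2 0 (by omega)).trans hs
    refine Runs.ite (fun hr => ?_) (fun hr => ?_)
    · refine (ha d s₁ hs₁).mono le_rfl fun s₂ ⟨h3, h4⟩ => ⟨?_, h2.trans_of_le h4 le_rfl⟩
      rw [h3, h2.envOf_eq, eval, if_pos (h1 ▸ hr)]
    · refine (hb d s₁ hs₁).mono le_rfl fun s₂ ⟨h3, h4⟩ => ⟨?_, h2.trans_of_le h4 le_rfl⟩
      rw [h3, h2.envOf_eq, eval, if_neg (by rw [← h1, hr]; simp)]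
  | sum i e he =>
    intro d s hs
    -- The bound variable itself is the loop counter, running down to `0`; register `2 * d + 3`
    -- saves its old value. The accumulator plus the terms still to come is the full sum.
    let Inv : ℕ → State → Prop := fun j s' => s'.reg (2 * i + 2) = j ∧ s'.mem = s.mem ∧
      s'.reg (2 * d + 3) = s.reg (2 * i + 2) ∧
      (∀ r, r % 2 = 0 ∨ r < 2 * d + 1 → r ≠ 2 * i + 2 → s'.reg r = s.reg r) ∧
      s'.reg (2 * d + 1) + ∑ v ∈ Finset.range j, e.eval G (Function.update (envOf s) i v) =
        (sum i e).eval G (envOf s)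
    refine Runs.const_seq (Runs.add_seq (Runs.add_seq (Runs.seq (Q := Inv 0) ?_ ?_)))
    · refine Runs.while Inv (fun j s' h => h.1) ?_ n _ ?_
      · rintro j s₁ ⟨h1, h2, h3, h4, h5⟩
        refine Runs.const_seq (Runs.sub_seq ?_)
        set s₂ := (s₁.setReg (2 * d + 5) 1).setReg (2 * i + 2)
          ((s₁.setReg (2 * d + 5) 1).reg (2 * i + 2) - (s₁.setReg (2 * d + 5) 1).reg (2 * d + 5))
          with hs₂
        have hreg : ∀ r, s₂.reg r = if r = 2 * i + 2 then j else if r = 2 * d + 5 then 1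
            else s₁.reg r := by
          intro r
          simp only [hs₂, State.setReg_reg]
          rw [if_neg (by omega : 2 * i + 2 ≠ 2 * d + 5), h1]
          simp
        have henv : envOf s₂ = Function.update (envOf s) i j := by
          funext l
          by_cases hl : l = i
          · simp [envOf, hreg, hl]
          · rw [Function.update_of_ne hl, envOf, hreg, if_neg (by omega), if_neg (by omega)]
            exact h4 _ (by omega) (by omega)
        have hs₂0 : s₂.reg 0 = n := by
          rw [hreg, if_neg (by omega), if_neg (by omega), h4 0 (by omega) (by omega), hs]
        refine (he (d + 2) s₂ hs₂0).seq fun s₃ ⟨h6, h7⟩ => Runs.add ⟨?_, ?_, ?_, ?_, ?_⟩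
        · rw [State.setReg_reg, if_neg (by omega), h7.2 _ (by omega), hreg, if_pos rfl]
        · rw [State.setReg_mem, h7.1]
          exact h2
        · rw [State.setReg_reg, if_neg (by omega), h7.2 _ (by omega), hreg, if_neg (by omega),
            if_neg (by omega), h3]
        · intro r hr hri
          rw [State.setReg_reg, if_neg (by omega), h7.2 _ (by omega), hreg, if_neg hri,
            if_neg (by omega), h4 r hr hri]
        · rw [State.setReg_reg, if_pos rfl, h7.2 _ (by omega), hreg, if_neg (by omega),
            if_neg (by omega), ← h5, Finset.sum_range_succ, ← henv, ← h6]
          show _ + s₃.reg (2 * d + 5) + _ = _ + (_ + s₃.reg (2 * d + 5))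
          omega
      · refine ⟨?_, rfl, ?_, ?_, ?_⟩
        · simp [hs]
        · simp
          rw [if_neg (by omega), if_neg (by omega)]
        · intro r hr hri
          simp only [State.setReg_reg]
          rw [if_neg hri, if_neg (by omega), if_neg (by omega)]
        · simp only [State.setReg_reg]
          rw [if_neg (by omega), if_neg (by omega), if_pos trivial, zero_add]
          rfl
    · rintro s₁ ⟨h1, h2, h3, h4, h5⟩
      refine Runs.const_seq (Runs.add ⟨?_, h2, fun r hr => ?_⟩)
      · rw [← h5]
        simp
        omega
      · by_cases hri : r = 2 * i + 2
        · simp [hri, h3]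
        · rw [State.setReg_reg, if_neg hri, State.setReg_reg, if_neg (by omega), h4 r hr hri]

/-- The variable `i` does not occur in the expression. -/
def Avoids (i : ℕ) : CountExpr → Prop
  | var j => j ≠ i
  | const _ => True
  | add a b => a.Avoids i ∧ b.Avoids i
  | sub a b => a.Avoids i ∧ b.Avoids i
  | adj a b => a.Avoids i ∧ b.Avoids i
  | ite c a b => c.Avoids i ∧ a.Avoids i ∧ b.Avoids i
  | sum j e => j ≠ i ∧ e.Avoids i

theorem Avoids.eval_update {n : ℕ} {G : SimpleGraph (Fin n)} {i : ℕ} {e : CountExpr}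
    (h : e.Avoids i) (env : ℕ → ℕ) (v : ℕ) :
    e.eval G (Function.update env i v) = e.eval G env := by
  induction e generalizing env with
  | var j => exact Function.update_of_ne h v env
  | const c => rfl
  | add a b ha hb => simp only [eval, ha h.1, hb h.2]
  | sub a b ha hb => simp only [eval, ha h.1, hb h.2]
  | adj a b ha hb => simp only [eval, ha h.1, hb h.2]
  | ite c a b hc ha hb => simp only [eval, hc h.1, ha h.2.1, hb h.2.2]
  | sum j e he =>
    simp only [eval]
    refine Finset.sum_congr rfl fun w _ => ?_
    rw [Function.update_comm h.1.symm, he h.2]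

end CountExpr

/-! ## The number of edits that make a set a module -/

open Classical in
/-- The number of edits of pairs at `v` that a set `X` with `v ∉ X` needs to become a module. -/
noncomputable def splitCost {V : Type*} (G : SimpleGraph V) (X : Set V) (v : V) : ℕ :=
  if v ∈ X then 0 else min {w | w ∈ X ∧ G.Adj v w}.ncard {w | w ∈ X ∧ ¬ G.Adj v w}.ncard

/-- Each vertex outside `X` must become adjacent to all or to none of `X`. The pairs concerned are
distinct for distinct outside vertices, so the cheaper choice can be made for each independently. -/
theorem isTModule_iff {V : Type*} [Fintype V] {G : SimpleGraph V} {t : ℕ} {X : Set V} :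
    IsTModule G t X ↔ ∑ v, splitCost G X v ≤ t := by
  classical
  constructor
  · rintro ⟨T, hT, hX⟩
    refine le_trans ?_ hT
    let F : V → Finset V := fun v => if v ∈ X then ∅ else
      Finset.univ.filter fun w => w ∈ X ∧ s(v, w) ∈ T
    have hF : ∀ v, splitCost G X v ≤ (F v).card := by
      intro v
      by_cases hv : v ∈ X
      · simp [splitCost, hv]
      · simp only [splitCost, F, if_neg hv]
        rw [← Set.ncard_coe_finset]
        by_cases hadj : ∃ x ∈ X, (edit G T).Adj x v
        · obtain ⟨x, hx, hxv⟩ := hadj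
          refine (min_le_right _ _).trans (Set.ncard_le_ncard ?_ (Set.toFinite _))
          rintro w ⟨hw, hvw⟩
          simp only [Finset.coe_filter, Finset.mem_univ, true_and]
          refine ⟨hw, ?_⟩
          by_contra hn
          have h1 := (hX x hx w hw v hv).1 hxv
          exact hvw ((edit_adj_of_notMem G hn).1 h1.symm)
        · refine (min_le_left _ _).trans (Set.ncard_le_ncard ?_ (Set.toFinite _))
          rintro w ⟨hw, hvw⟩
          simp only [Finset.coe_filter, Finset.mem_univ, true_and]
          refine ⟨hw, ?_⟩
          by_contra hn
          exact hadj ⟨w, hw, ((edit_adj_of_notMem G hn).2 hvw).symm⟩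
    calc ∑ v, splitCost G X v ≤ ∑ v, (F v).card := Finset.sum_le_sum fun v _ => hF v
      _ = (Finset.univ.sigma F).card := (Finset.card_sigma _ _).symm
      _ ≤ T.card := by
        refine Finset.card_le_card_of_injOn (fun p => s(p.1, p.2)) ?_ ?_
        · rintro ⟨v, w⟩ hp
          have hp' : w ∈ F v := by simpa using hp
          by_cases hv : v ∈ X
          · simp [F, hv] at hp'
          · simp only [F, if_neg hv, Finset.mem_filter] at hp'
            exact hp'.2.2
        · rintro ⟨v, w⟩ hp ⟨v', w'⟩ hp' heq
          have h1 : w ∈ F v := by simpa using hp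
          have h2 : w' ∈ F v' := by simpa using hp'
          by_cases hv : v ∈ X
          · simp [F, hv] at h1
          by_cases hv' : v' ∈ X
          · simp [F, hv'] at h2
          simp only [F, if_neg hv, if_neg hv', Finset.mem_filter] at h1 h2
          rcases Sym2.eq_iff.1 heq with ⟨h3, h4⟩ | ⟨h3, h4⟩
          · simp only at h3 h4
            rw [h3, h4]
          · simp only at h3
            exact absurd (h3 ▸ h2.2.1) hv
  · intro h
    let E : V → Finset V := fun v =>
      if {w | w ∈ X ∧ G.Adj v w}.ncard ≤ {w | w ∈ X ∧ ¬ G.Adj v w}.ncard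
      then Finset.univ.filter fun w => w ∈ X ∧ G.Adj v w
      else Finset.univ.filter fun w => w ∈ X ∧ ¬ G.Adj v w
    have hEX : ∀ v w, w ∈ E v → w ∈ X := by
      intro v w hw
      simp only [E] at hw
      split_ifs at hw <;> exact (Finset.mem_filter.1 hw).2.1
    have hE : ∀ v, v ∉ X → (E v).card = splitCost G X v := by
      intro v hv
      simp only [E, splitCost, if_neg hv]
      split_ifs with hle
      · rw [min_eq_left hle, ← Set.ncard_coe_finset]
        congr 1
        ext w
        simp
      · rw [min_eq_right (not_le.1 hle).le, ← Set.ncard_coe_finset]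
        congr 1
        ext w
        simp
    let U : Finset V := Finset.univ.filter fun v => v ∉ X
    let T : Finset (Sym2 V) := U.biUnion fun v => (E v).image fun w => s(v, w)
    have hT : ∀ x ∈ X, ∀ v, v ∉ X → (s(x, v) ∈ T ↔ x ∈ E v) := by
      intro x hx v hv
      simp only [T, U, Finset.mem_biUnion, Finset.mem_filter, Finset.mem_univ, true_and,
        Finset.mem_image]
      constructor
      · rintro ⟨v', hv', w, hw, heq⟩
        rcases Sym2.eq_iff.1 heq with ⟨h1, h2⟩ | ⟨h1, h2⟩
        · exact absurd (h1 ▸ hx) hv'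
        · rwa [← h1, ← h2]
      · exact fun hxv => ⟨v, hv, x, hxv, Sym2.eq_swap⟩
    refine ⟨T, le_trans ?_ h, ?_⟩
    · calc T.card ≤ ∑ v ∈ U, ((E v).image fun w => s(v, w)).card := Finset.card_biUnion_le
        _ ≤ ∑ v ∈ U, splitCost G X v := by
          refine Finset.sum_le_sum fun v hv => ?_
          rw [← hE v (Finset.mem_filter.1 hv).2]
          exact Finset.card_image_le
        _ ≤ ∑ v, splitCost G X v :=
          Finset.sum_le_sum_of_subset (Finset.subset_univ _)
    · have key : ∀ x ∈ X, ∀ v, v ∉ X → ((edit G T).Adj x v ↔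
          ¬ {w | w ∈ X ∧ G.Adj v w}.ncard ≤ {w | w ∈ X ∧ ¬ G.Adj v w}.ncard) := by
        intro x hx v hv
        have hne : x ≠ v := by
          rintro rfl
          exact hv hx
        rw [edit_adj, hT x hx v hv, G.adj_comm x v]
        simp only [E]
        split_ifs with hle <;> by_cases hadj : G.Adj v x <;> simp [hx, hadj, hle, hne]
      intro x hx y hy v hv
      rw [key x hx v hv, key y hy v hv]

namespace CountExpr

variable {n : ℕ} {G : SimpleGraph (Fin n)} {env : ℕ → ℕ} {a b e : CountExpr}

/-! ## Conditions as expressions -/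

/-- An expression is read as the condition that its value is not zero. -/
def Holds (G : SimpleGraph (Fin n)) (env : ℕ → ℕ) (e : CountExpr) : Prop := e.eval G env ≠ 0

def not (a : CountExpr) : CountExpr := .sub (.const 1) a

def and (a b : CountExpr) : CountExpr := .ite a b (.const 0)

def or (a b : CountExpr) : CountExpr := .ite a (.const 1) b

def lt (a b : CountExpr) : CountExpr := .sub b a

def eq (a b : CountExpr) : CountExpr := (CountExpr.lt a b).or (.lt b a) |>.not

def ex (i : ℕ) (a : CountExpr) : CountExpr := .sum i a

def all (i : ℕ) (a : CountExpr) : CountExpr := (ex i a.not).not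

/-- The number of values of the variable `i` for which `a` holds. -/
def count (i : ℕ) (a : CountExpr) : CountExpr := .sum i (.ite a (.const 1) (.const 0))

/-- The least value of the variable `i` for which `a` holds. The variable `j` is auxiliary. -/
def least (i j : ℕ) (a : CountExpr) : CountExpr :=
  .sum j (.not (.ex i (.and (.not (.lt (.var j) (.var i))) a)))

@[simp] theorem holds_not : Holds G env a.not ↔ ¬ Holds G env a := by
  simp only [Holds, not, eval]
  omega

@[simp] theorem holds_and : Holds G env (a.and b) ↔ Holds G env a ∧ Holds G env b := by
  by_cases h : a.eval G env = 0 <;> simp [Holds, and, eval, h]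

@[simp] theorem holds_or : Holds G env (a.or b) ↔ Holds G env a ∨ Holds G env b := by
  by_cases h : a.eval G env = 0 <;> simp [Holds, or, eval, h]

@[simp] theorem holds_lt : Holds G env (a.lt b) ↔ a.eval G env < b.eval G env := by
  simp only [Holds, lt, eval]
  omega

@[simp] theorem holds_eq : Holds G env (a.eq b) ↔ a.eval G env = b.eval G env := by
  simp only [eq, holds_not, holds_or, holds_lt]
  omega

theorem holds_ex' {i : ℕ} :
    Holds G env (ex i a) ↔ ∃ v < n, Holds G (Function.update env i v) a := by
  simp [Holds, ex, eval, Finset.sum_eq_zero_iff]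

@[simp] theorem holds_ex {i : ℕ} :
    Holds G env (ex i a) ↔ ∃ v : Fin n, Holds G (Function.update env i v) a := by
  rw [holds_ex']
  exact ⟨fun ⟨v, hv, h⟩ => ⟨⟨v, hv⟩, h⟩, fun ⟨v, h⟩ => ⟨v, v.2, h⟩⟩

@[simp] theorem holds_all {i : ℕ} :
    Holds G env (all i a) ↔ ∀ v : Fin n, Holds G (Function.update env i v) a := by
  simp [all]

@[simp] theorem eval_count {i : ℕ} :
    (count i a).eval G env = {v : Fin n | Holds G (Function.update env i v) a}.ncard := by
  classical
  rw [Set.ncard_eq_toFinset_card', Set.toFinset_card, Fintype.card_subtype, Finset.card_filter,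
    count, eval, ← Fin.sum_univ_eq_sum_range
      (fun v => (CountExpr.ite a (.const 1) (.const 0)).eval G (Function.update env i v))]
  refine Finset.sum_congr rfl fun v _ => ?_
  by_cases h : a.eval G (Function.update env i v) = 0 <;> simp [eval, Holds, h]

theorem holds_adj_var {i j : ℕ} {v w : Fin n} (hi : env i = v) (hj : env j = w) :
    Holds G env (.adj (.var i) (.var j)) ↔ G.Adj v w := by
  rw [Holds, eval, eval, eval, hi, hj]
  simp [adjEntry]

theorem Avoids.holds_update {i : ℕ} (h : e.Avoids i) (v : ℕ) :
    Holds G (Function.update env i v) e ↔ Holds G env e := by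
  rw [Holds, h.eval_update, Holds]

/-- The values of `j` with no witness `i ≤ j` are exactly those below the least witness, so their
number equals it. -/
theorem holds_update_least {i j : ℕ} (hij : i ≠ j) (ha : a.Avoids j) (h : Holds G env (ex i a)) :
    Holds G (Function.update env i ((least i j a).eval G env)) a := by
  classical
  rw [holds_ex'] at h
  obtain ⟨m, ⟨hmn, hm⟩, hle⟩ : ∃ m, (m < n ∧ Holds G (Function.update env i m) a) ∧
      ∀ w, m ≤ w ↔ ∃ v ≤ w, v < n ∧ Holds G (Function.update env i v) a :=
    ⟨Nat.find h, Nat.find_spec h, fun w => Nat.find_le_iff h w⟩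
  suffices hval : (least i j a).eval G env = m by rwa [hval]
  have hterm : ∀ w ∈ Finset.range n,
      (CountExpr.not (.ex i (.and (.not (.lt (.var j) (.var i))) a))).eval G
        (Function.update env j w) = if w < m then 1 else 0 := by
    intro w hw
    have hiff : Holds G (Function.update env j w)
        (.ex i (.and (.not (.lt (.var j) (.var i))) a)) ↔ m ≤ w := by
      rw [holds_ex', hle]
      refine exists_congr fun v => ?_
      rw [holds_and, holds_not, holds_lt, Function.update_comm hij.symm, ha.holds_update]
      have h1 : Function.update (Function.update env i v) j w i = v := by simp [hij]
      simp only [eval, Function.update_self, h1]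
      constructor
      · rintro ⟨h2, h3, h4⟩
        exact ⟨by omega, h2, h4⟩
      · rintro ⟨h2, h3, h4⟩
        exact ⟨h3, by omega, h4⟩
    rw [Holds] at hiff
    rw [not, eval, eval]
    split_ifs with hw' <;> omega
  rw [least, eval, Finset.sum_congr rfl hterm, ← Finset.sum_filter, Finset.sum_const,
    smul_eq_mul, mul_one]
  have : (Finset.range n).filter (fun w => w < m) = Finset.range m := by
    ext w
    simp only [Finset.mem_filter, Finset.mem_range]
    omega
  rw [this, Finset.card_range]

/-! ## The conditions of a nested `t`-module as expressions

The variables are `k`, `t`, `x`, `x'`, `y`, `y'`, `z`, `z'`, in this order from `0` to `7`, and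
bound variables from `8` on. -/

def distinguishes (x x' v : ℕ) : CountExpr :=
  .ite (.adj (.var v) (.var x)) (.not (.adj (.var v) (.var x'))) (.adj (.var v) (.var x'))

/-- The index in `A, B, C, K, I` of the set that contains the vertex `v`. -/
def part (v : ℕ) : CountExpr :=
  .ite (distinguishes 2 3 v) (.const 0)
    (.ite (distinguishes 4 5 v) (.const 1)
      (.ite (distinguishes 6 7 v) (.const 2)
        (.ite (.adj (.var v) (.var 2)) (.const 3) (.const 4))))

/-- The vertex `v` is in one of the first `j` sets. -/
def inFirst (j v : ℕ) : CountExpr := .lt (part v) (.const j)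

def inPart (j v : ℕ) : CountExpr := .eq (part v) (.const j)

def minimum (a b : CountExpr) : CountExpr := .sub a (.sub a b)

def tmoduleExpr (X : ℕ → CountExpr) : CountExpr :=
  .not (.lt (.var 1) (.sum 9 (.ite (X 9) (.const 0)
    (minimum (count 10 (.and (X 10) (.adj (.var 9) (.var 10))))
      (count 10 (.and (X 10) (.not (.adj (.var 9) (.var 10)))))))))

def imp (a b : CountExpr) : CountExpr := .or (.not a) b

def attachedPartExpr (s : CountExpr → CountExpr) (Y X : ℕ → CountExpr) : CountExpr :=
  .lt (.add (.var 1) (.add (.var 1) (.var 1)))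
    (count 9 (.and (Y 9) (.and (all 10 (imp (X 10) (s (.adj (.var 9) (.var 10)))))
      (.and (all 10 (imp (inPart 3 10) (.adj (.var 9) (.var 10))))
        (all 10 (imp (inPart 4 10) (.not (.adj (.var 9) (.var 10)))))))))

/-- The nested `t`-module rule applies. -/
def ruleExpr : CountExpr :=
  .and (.and (ex 9 (inPart 0 9)) (.and (ex 9 (inPart 1 9)) (.and (ex 9 (inPart 2 9))
    (.and (ex 9 (inPart 3 9)) (ex 9 (inPart 4 9))))))
  (.and (tmoduleExpr (inFirst 1)) (.and (tmoduleExpr (inFirst 2)) (.and (tmoduleExpr (inFirst 3))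
  (.and (.lt (.add (.var 0) (.var 1)) (count 9 (inPart 0 9)))
  (.and (attachedPartExpr id (inPart 1) (inFirst 1))
  (.and (attachedPartExpr not (inPart 1) (inFirst 1))
  (.and (attachedPartExpr id (inPart 2) (inFirst 2))
  (.and (attachedPartExpr not (inPart 2) (inFirst 2))
    (.or (ex 9 (.and (inPart 0 9) (ex 10 (.and (inPart 4 10) (.adj (.var 9) (.var 10))))))
      (ex 9 (.and (inPart 0 9)
        (ex 10 (.and (inPart 3 10) (.not (.adj (.var 9) (.var 10))))))))))))))))

/-- `X u` expresses that the value of the variable `u` is in `M`. -/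
def Expresses (G : SimpleGraph (Fin n)) (env : ℕ → ℕ) (X : ℕ → CountExpr) (M : Set (Fin n)) :
    Prop :=
  ∀ (env' : ℕ → ℕ) (u : ℕ) (v : Fin n), (∀ i < 8, env' i = env i) → env' u = v → (Holds G env' (X u) ↔ v ∈ M)

/-- Because `Expresses` ranges over all environments that agree on the first eight variables, `X`
may be used under the binders `9` and `10`. -/
theorem Expresses.holds_fst {X : ℕ → CountExpr} {M : Set (Fin n)} (h : Expresses G env X M)
    (v : Fin n) : Holds G (Function.update env 9 v) (X 9) ↔ v ∈ M :=
  h _ _ _ (fun i hi => Function.update_of_ne (by omega) _ _) (by simp)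

theorem Expresses.holds_snd {X : ℕ → CountExpr} {M : Set (Fin n)} (h : Expresses G env X M)
    (v w : Fin n) :
    Holds G (Function.update (Function.update env 9 v) 10 w) (X 10) ↔ w ∈ M :=
  h _ _ _ (fun i hi => by
    rw [Function.update_of_ne (by omega), Function.update_of_ne (by omega)]) (by simp)

theorem holds_adj_fst_snd (v w : Fin n) :
    Holds G (Function.update (Function.update env 9 v) 10 w) (.adj (.var 9) (.var 10)) ↔
      G.Adj v w :=
  holds_adj_var (by simp) (by simp)

@[simp] theorem holds_imp : Holds G env (imp a b) ↔ (Holds G env a → Holds G env b) := by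
  simp [imp, imp_iff_not_or]

theorem holds_tmoduleExpr {X : ℕ → CountExpr} {M : Set (Fin n)} (h : Expresses G env X M) :
    Holds G env (tmoduleExpr X) ↔ IsTModule G (env 1) M := by
  rw [isTModule_iff, tmoduleExpr, holds_not, holds_lt, not_lt, eval, eval,
    ← Fin.sum_univ_eq_sum_range (fun v => eval G _ (Function.update env 9 v))]
  have : ∀ v : Fin n, eval G (.ite (X 9) (.const 0)
      (minimum (count 10 (.and (X 10) (.adj (.var 9) (.var 10))))
      (count 10 (.and (X 10) (.not (.adj (.var 9) (.var 10)))))))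
      (Function.update env 9 v) = splitCost G M v := by
    intro v
    have h1 := h.holds_fst v
    simp only [Holds] at h1
    by_cases hv : v ∈ M
    · simp only [splitCost, eval, if_pos hv, if_pos (h1.2 hv)]
    · simp only [splitCost, eval, if_neg hv, if_neg (fun h' => hv (h1.1 h')), minimum, eval_count,
        holds_and, holds_not, h.holds_snd, holds_adj_fst_snd]
      omega
  simp only [this]

theorem holds_attachedPartExpr {X Y : ℕ → CountExpr} {M M' K I : Set (Fin n)}
    {s : CountExpr → CountExpr} {P : Prop → Prop} (hs : ∀ env a, Holds G env (s a) ↔ P (Holds G env a))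
    (hY : Expresses G env Y M') (hX : Expresses G env X M)
    (hK : Expresses G env (inPart 3) K) (hI : Expresses G env (inPart 4) I) :
    Holds G env (attachedPartExpr s Y X) ↔ 3 * env 1 + 1 ≤
      {b ∈ M' | (∀ a ∈ M, P (G.Adj b a)) ∧ (∀ c ∈ K, G.Adj b c) ∧ ∀ i ∈ I, ¬ G.Adj b i}.ncard := by
  rw [attachedPartExpr, holds_lt]
  simp only [eval, eval_count, holds_and, holds_all, holds_imp, holds_not, hs, hX.holds_snd,
    hK.holds_snd, hI.holds_snd, hY.holds_fst, holds_adj_fst_snd]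
  show env 1 + (env 1 + env 1) < _ ↔ _
  omega

theorem eval_part_congr {env env' : ℕ → ℕ} (h : ∀ i < 8, env' i = env i) {u v : ℕ}
    (huv : env' u = env v) : (part u).eval G env' = (part v).eval G env := by
  simp only [part, distinguishes, eval, not, huv, h 2 (by omega), h 3 (by omega), h 4 (by omega),
    h 5 (by omega), h 6 (by omega), h 7 (by omega)]
  rfl

/-- The vertices with index `j` among the sets `A, B, C, K, I`. -/
def partSet (G : SimpleGraph (Fin n)) (env : ℕ → ℕ) (j : ℕ) : Set (Fin n) :=
  {v | (part 8).eval G (Function.update env 8 v) = j}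

theorem eval_part {env' : ℕ → ℕ} {u : ℕ} {v : Fin n} (h : ∀ i < 8, env' i = env i)
    (hu : env' u = v) :
    (part u).eval G env' = (part 8).eval G (Function.update env 8 v) := by
  refine eval_part_congr (fun i hi => ?_) (by simpa using hu)
  rw [h i hi, Function.update_of_ne (by omega)]

theorem expresses_inPart (j : ℕ) : Expresses G env (inPart j) (partSet G env j) := by
  intro env' u v h hu
  rw [inPart, holds_eq, eval_part h hu]
  rfl

theorem expresses_inFirst (j : ℕ) :
    Expresses G env (inFirst j) {v | (part 8).eval G (Function.update env 8 v) < j} := by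
  intro env' u v h hu
  rw [inFirst, holds_lt, eval_part h hu]
  rfl

theorem eval_part_le (u : ℕ) : (part u).eval G env ≤ 4 := by
  have key : ∀ {p : Prop} [Decidable p] {a b : ℕ}, a ≤ 4 → b ≤ 4 → (if p then a else b) ≤ 4 := by
    intro p _ a b ha hb
    split_ifs <;> assumption
  exact key (by simp [eval]) (key (by simp [eval]) (key (by simp [eval])
    (key (by simp [eval]) (by simp [eval]))))

/-- Covering and disjointness need no test: `part` gives every vertex exactly one index, at most
`4`. The environment is arbitrary, so this also covers values that are not vertices. -/
theorem holds_ruleExpr : Holds G env ruleExpr ↔ NestedRuleApplies G (env 0) (env 1)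
    (partSet G env 0) (partSet G env 1) (partSet G env 2) (partSet G env 3) (partSet G env 4) := by
  have e1 : {v : Fin n | (part 8).eval G (Function.update env 8 v) < 1} = partSet G env 0 := by
    ext v
    simp only [partSet, Set.mem_ofPred_eq]
    omega
  have e2 : {v : Fin n | (part 8).eval G (Function.update env 8 v) < 2} =
      partSet G env 0 ∪ partSet G env 1 := by
    ext v
    simp only [partSet, Set.mem_ofPred_eq, Set.mem_union]
    omega
  have e3 : {v : Fin n | (part 8).eval G (Function.update env 8 v) < 3} =
      partSet G env 0 ∪ partSet G env 1 ∪ partSet G env 2 := by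
    ext v
    simp only [partSet, Set.mem_ofPred_eq, Set.mem_union]
    omega
  have p := fun j => expresses_inPart (G := G) (env := env) j
  have f1 := expresses_inFirst (G := G) (env := env) 1
  have f2 := expresses_inFirst (G := G) (env := env) 2
  have f3 := expresses_inFirst (G := G) (env := env) 3
  rw [e1] at f1
  rw [e2] at f2
  rw [e3] at f3
  have hj : ∀ {Y X M' M}, Expresses G env Y M' → Expresses G env X M →
      (Holds G env (attachedPartExpr id Y X) ↔
        3 * env 1 + 1 ≤ (joinedPart G M' M (partSet G env 3) (partSet G env 4)).ncard) :=
    fun hY hX => holds_attachedPartExpr (P := id) (fun _ _ => Iff.rfl) hY hX (p 3) (p 4)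
  have hn : ∀ {Y X M' M}, Expresses G env Y M' → Expresses G env X M →
      (Holds G env (attachedPartExpr not Y X) ↔
        3 * env 1 + 1 ≤ (separatedPart G M' M (partSet G env 3) (partSet G env 4)).ncard) :=
    fun hY hX => holds_attachedPartExpr (P := Not) (fun _ _ => holds_not) hY hX (p 3) (p 4)
  have hdisj : ∀ {i j}, i ≠ j → Disjoint (partSet G env i) (partSet G env j) := by
    intro i j hij
    rw [Set.disjoint_left]
    exact fun v hi hj => hij (Eq.trans (Eq.symm hi) hj)
  rw [ruleExpr]
  simp only [holds_and, holds_or, holds_ex, holds_tmoduleExpr f1, holds_tmoduleExpr f2,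
    holds_tmoduleExpr f3, hj (p 1) f1, hn (p 1) f1, hj (p 2) f2, hn (p 2) f2, holds_lt, eval,
    eval_count, (p _).holds_fst, (p _).holds_snd, holds_adj_fst_snd, holds_not]
  constructor
  · rintro ⟨hne, h1, h2, h3, h4, h5, h6, h7, h8, h9⟩
    refine ⟨⟨hne, ?_, ?_, h1, h2, h3, h4, h5, h6, h7, h8⟩, h9⟩
    · ext v
      have := eval_part_le (G := G) (env := Function.update env 8 v) 8
      simp only [partSet, Set.mem_ofPred_eq, Set.mem_union, Set.mem_univ, iff_true]
      omega
    · simp only [List.pairwise_cons, List.mem_cons, List.not_mem_nil, or_false, forall_eq_or_imp,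
        forall_eq, false_imp_iff, implies_true, List.Pairwise.nil, and_true]
      exact ⟨⟨hdisj (by omega), hdisj (by omega), hdisj (by omega), hdisj (by omega)⟩,
        ⟨hdisj (by omega), hdisj (by omega), hdisj (by omega)⟩,
        ⟨hdisj (by omega), hdisj (by omega)⟩, hdisj (by omega)⟩
  · rintro ⟨⟨hne, -, -, h1, h2, h3, h4, h5, h6, h7, h8⟩, h9⟩
    exact ⟨hne, h1, h2, h3, h4, h5, h6, h7, h8, h9⟩

theorem eval_ite_of_holds {c a b : CountExpr} (h : Holds G env c) :
    (ite c a b).eval G env = a.eval G env := if_pos h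

theorem eval_ite_of_not_holds {c a b : CountExpr} (h : ¬ Holds G env c) :
    (ite c a b).eval G env = b.eval G env := if_neg h

theorem holds_distinguishes {a b u : ℕ} {x x' v : Fin n} (ha : env a = x) (hb : env b = x')
    (hu : env u = v) : Holds G env (distinguishes a b u) ↔ v ∈ distinguishers G x x' := by
  have h1 := holds_adj_var (G := G) hu ha
  have h2 := holds_adj_var (G := G) hu hb
  show _ ↔ Xor (G.Adj v x) (G.Adj v x')
  rw [← h1, ← h2]
  by_cases h : Holds G env (.adj (.var u) (.var a))
  · have : Holds G env (distinguishes a b u) ↔ Holds G env (.not (.adj (.var u) (.var b))) := by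
      rw [Holds, distinguishes, eval_ite_of_holds h, Holds]
    rw [this, holds_not]
    simp [h]
  · have : Holds G env (distinguishes a b u) ↔ Holds G env (.adj (.var u) (.var b)) := by
      rw [Holds, distinguishes, eval_ite_of_not_holds h, Holds]
    rw [this]
    simp [h]

/-- The cascade in `part` takes the first match, which performs the set differences of
`DeterminedBy`. -/
theorem partSet_eq {x x' y y' z z' : Fin n} {A B C K I : Set (Fin n)}
    (h : DeterminedBy G x x' y y' z z' A B C K I) (h2 : env 2 = x) (h3 : env 3 = x')
    (h4 : env 4 = y) (h5 : env 5 = y') (h6 : env 6 = z) (h7 : env 7 = z') :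
    partSet G env 0 = A ∧ partSet G env 1 = B ∧ partSet G env 2 = C ∧ partSet G env 3 = K ∧
      partSet G env 4 = I := by
  obtain ⟨rfl, rfl, rfl, rfl, rfl⟩ := h
  have key : ∀ v : Fin n, ∀ j, v ∈ partSet G env j ↔
      (v ∈ distinguishers G x x' ∧ j = 0) ∨ (v ∉ distinguishers G x x' ∧
      ((v ∈ distinguishers G y y' ∧ j = 1) ∨ (v ∉ distinguishers G y y' ∧
      ((v ∈ distinguishers G z z' ∧ j = 2) ∨ (v ∉ distinguishers G z z' ∧
      ((G.Adj v x ∧ j = 3) ∨ (¬ G.Adj v x ∧ j = 4))))))) := by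
    intro v j
    have e : ∀ i < 8, Function.update env 8 (v : ℕ) i = env i := fun i hi =>
      Function.update_of_ne (by omega) _ _
    have e8 : Function.update env 8 (v : ℕ) 8 = v := Function.update_self _ _ _
    have d1 := holds_distinguishes (G := G) ((e 2 (by omega)).trans h2)
      ((e 3 (by omega)).trans h3) e8
    have d2 := holds_distinguishes (G := G) ((e 4 (by omega)).trans h4)
      ((e 5 (by omega)).trans h5) e8
    have d3 := holds_distinguishes (G := G) ((e 6 (by omega)).trans h6)
      ((e 7 (by omega)).trans h7) e8
    have d4 := holds_adj_var (G := G) e8 ((e 2 (by omega)).trans h2)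
    rw [← d1, ← d2, ← d3, ← d4]
    show (part 8).eval G _ = j ↔ _
    have hite : ∀ c a b : CountExpr, (ite c a b).eval G (Function.update env 8 v) = j ↔
        (Holds G (Function.update env 8 v) c ∧ a.eval G (Function.update env 8 v) = j) ∨
        (¬ Holds G (Function.update env 8 v) c ∧ b.eval G (Function.update env 8 v) = j) := by
      intro c a b
      by_cases hc : Holds G (Function.update env 8 v) c
      · rw [eval_ite_of_holds hc]
        simp [hc]
      · rw [eval_ite_of_not_holds hc]
        simp [hc]
    rw [part, hite, hite, hite, hite]
    simp only [eval, eq_comm (b := j)]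
  refine ⟨?_, ?_, ?_, ?_, ?_⟩ <;> ext v <;> rw [key] <;>
    simp only [Set.mem_sdiff, Set.mem_union, Set.mem_ofPred_eq] <;> simp <;> tauto

theorem partSet_congr {env' : ℕ → ℕ} (h : ∀ i < 8, env' i = env i) (j : ℕ) :
    partSet G env' j = partSet G env j := by
  ext v
  have : (part 8).eval G (Function.update env' 8 v) = (part 8).eval G (Function.update env 8 v) :=
    eval_part (fun i hi => by rw [Function.update_of_ne (by omega), h i hi])
      (Function.update_self _ _ _)
  simp only [partSet, Set.mem_ofPred_eq, this]

theorem holds_ruleExpr_congr {env' : ℕ → ℕ} (h : ∀ i < 8, env' i = env i) :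
    Holds G env' ruleExpr ↔ Holds G env ruleExpr := by
  simp only [holds_ruleExpr, partSet_congr h, h 0 (by omega), h 1 (by omega)]

/-! ## The program -/

/-- Existential quantification over the values of several variables. -/
def exs : List ℕ → CountExpr → CountExpr
  | [], e => e
  | i :: l, e => ex i (exs l e)

/-- Assign the value of an expression to the variable `i`. -/
def assign (i : ℕ) (e : CountExpr) : Program :=
  .seq (e.compile 0) (.seq (.const 3 0) (.add (2 * i + 2) 1 3))

/-- Find values of several variables for which `e` holds. -/
def search (e : CountExpr) : List ℕ → Program
  | [] => .const 3 0
  | i :: l => .seq (assign i (least i 20 (exs l e))) (search e l)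

def searchCost (n : ℕ) (e : CountExpr) : List ℕ → ℕ
  | [] => 1
  | i :: l => ((least i 20 (exs l e)).cost n + (1 + 1)) + searchCost n e l

theorem runs_assign (i : ℕ) (e : CountExpr) (s : State) (hs : s.reg 0 = n) :
    Runs G (assign i e) s (e.cost n + (1 + 1)) fun s' => s'.reg 0 = n ∧
      envOf s' = Function.update (envOf s) i (e.eval G (envOf s)) := by
  refine (runs_compile G e 0 s hs).seq fun s₁ ⟨h1, h2⟩ => Runs.const_seq (Runs.add ⟨?_, ?_⟩)
  · simp [h2.2 0 (by omega), hs]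
  · funext l
    by_cases hl : l = i
    · subst hl
      simpa [envOf] using h1
    · rw [Function.update_of_ne hl, ← h2.envOf_eq]
      simp only [envOf, State.setReg_reg]
      rw [if_neg (by omega), if_neg (by omega)]

theorem Avoids.exs {e : CountExpr} {j : ℕ} (he : e.Avoids j) :
    ∀ {l : List ℕ}, j ∉ l → (exs l e).Avoids j
  | [], _ => he
  | i :: _, h => ⟨fun hij => h (by simp [hij]), Avoids.exs he (fun hj => h (by simp [hj]))⟩

/-- Each assignment keeps the remaining existential statement true. Without a witness the values
found are meaningless, so the conclusion is conditional. -/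
theorem runs_search {e : CountExpr} (he : e.Avoids 20) (l : List ℕ) :
    20 ∉ l → ∀ s : State, s.reg 0 = n → Runs G (search e l) s (searchCost n e l) fun s' =>
      s'.reg 0 = n ∧ (∀ i, i ∉ l → envOf s' i = envOf s i) ∧
        (Holds G (envOf s) (exs l e) → Holds G (envOf s') e) := by
  induction l with
  | nil =>
    intro _ s hs
    have henv : envOf (s.setReg 3 0) = envOf s := by
      funext i
      simp only [envOf, State.setReg_reg]
      rw [if_neg (by omega)]
    refine Runs.const ⟨by simp [hs], fun i _ => by rw [henv], fun h => ?_⟩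
    rw [henv]
    exact h
  | cons i l ih =>
    intro hl s hs
    simp only [List.mem_cons, not_or] at hl
    refine (runs_assign i (least i 20 (exs l e)) s hs).seq fun s₁ ⟨h1, h2⟩ => ?_
    refine (ih hl.2 s₁ h1).mono le_rfl fun s₂ ⟨h3, h4, h5⟩ => ⟨h3, fun j hj => ?_, fun h => h5 ?_⟩
    · simp only [List.mem_cons, not_or] at hj
      rw [h4 j hj.2, h2, Function.update_of_ne hj.1]
    · rw [h2]
      exact holds_update_least (Ne.symm hl.1) (he.exs hl.2) h

/-- Write the index of the set of each vertex into the array. -/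
def fill : Program :=
  .seq (.const 1 0) (.seq (.add 18 0 1) (.while 18 (.seq (.const 1 1) (.seq (.sub 18 18 1)
    (.seq ((part 8).compile 0) (.store 18 1))))))

/-- Register `18` holds the variable `8`, so the loop counter is also the vertex at which `part 8`
is evaluated. -/
theorem runs_fill (s : State) (hs : s.reg 0 = n) :
    Runs G fill s (1 + (1 + (n * ((1 + (1 + ((part 8).cost n + 1))) + 1) + 1))) fun s' =>
      s'.reg 0 = n ∧ (∀ i < 8, envOf s' i = envOf s i) ∧
        ∀ v < n, s'.mem v = (part 8).eval G (Function.update (envOf s) 8 v) := by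
  let Inv : ℕ → State → Prop := fun j s' => s'.reg 18 = j ∧ s'.reg 0 = n ∧
    (∀ i, i ≠ 8 → envOf s' i = envOf s i) ∧
    ∀ v, j ≤ v → v < n → s'.mem v = (part 8).eval G (Function.update (envOf s) 8 v)
  refine Runs.const_seq (Runs.add_seq (Runs.mono (Q := Inv 0) ?_ le_rfl fun s' h =>
    ⟨h.2.1, fun i hi => h.2.2.1 i (by omega), fun v hv => h.2.2.2 v (Nat.zero_le v) hv⟩))
  refine Runs.while Inv (fun j s' h => h.1) ?_ n _ ?_
  · rintro j s₁ ⟨h1, h2, h3, h4⟩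
    refine Runs.const_seq (Runs.sub_seq ?_)
    set s₂ := (s₁.setReg 1 1).setReg 18 ((s₁.setReg 1 1).reg 18 - (s₁.setReg 1 1).reg 1) with hs₂
    have hreg : ∀ r, s₂.reg r = if r = 18 then j else if r = 1 then 1 else s₁.reg r := by
      intro r
      simp [hs₂, h1]
    have henv : envOf s₂ = Function.update (envOf s) 8 j := by
      funext l
      by_cases hl : l = 8
      · simp [envOf, hreg, hl]
      · rw [Function.update_of_ne hl, envOf, hreg, if_neg (by omega), if_neg (by omega)]
        exact h3 l hl
    refine (runs_compile G (part 8) 0 s₂ (by simp [hreg, h2])).seq fun s₃ ⟨h5, h6⟩ =>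
      Runs.store ?_
    have h18 : s₃.reg 18 = j := by rw [h6.2 18 (by omega), hreg, if_pos rfl]
    refine ⟨h18, ?_, fun i hi => ?_, fun v hjv hvn => ?_⟩
    · rw [State.setMem_reg, h6.2 0 (by omega)]
      simp [hreg, h2]
    · show envOf s₃ i = _
      rw [h6.envOf_eq, henv, Function.update_of_ne hi]
    · rw [State.setMem_mem, h18]
      split_ifs with hv
      · rw [hv, ← henv]
        exact h5
      · rw [h6.1]
        exact h4 v (by omega) hvn
  · refine ⟨by simp [hs], by simp [hs], fun i hi => ?_, fun v hv hv' => absurd hv' (not_lt.2 hv)⟩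
    simp only [envOf, State.setReg_reg]
    rw [if_neg (by omega), if_neg (by omega)]

/-- Detection of a nested `t`-module to which the nested `t`-module rule applies. -/
def detect : Program :=
  .seq (.const 3 0) (.seq (.add 2 1 3) (.seq (search ruleExpr [1, 2, 3, 4, 5, 6, 7])
    (.seq fill (.seq (ruleExpr.compile 0)
      (.seq (.const 3 0) (.seq (.add 0 1 3) (.add 1 4 3)))))))

def detectCost (n : ℕ) : ℕ :=
  1 + (1 + (searchCost n ruleExpr [1, 2, 3, 4, 5, 6, 7] +
    ((1 + (1 + (n * ((1 + (1 + ((part 8).cost n + 1))) + 1) + 1))) +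
      (ruleExpr.cost n + (1 + (1 + 1))))))

theorem avoids_ruleExpr : ruleExpr.Avoids 20 := by
  simp [ruleExpr, Avoids, tmoduleExpr, attachedPartExpr, inPart, inFirst, part, distinguishes, not,
    and, or, ex, all, lt, eq, imp, count, minimum]

/-- Soundness comes from evaluating `ruleExpr` again after the search, whatever the search found;
completeness from the search succeeding when a witness exists. Register `0` returns the verdict,
register `1` the value of `t`, and the array the five sets. -/
theorem runs_detect (k : ℕ) : Runs G detect (State.init n k) (detectCost n) fun s =>
    (s.reg 0 ≠ 0 → NestedRuleApplies G k (s.reg 1)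
      (s.cls n 0) (s.cls n 1) (s.cls n 2) (s.cls n 3) (s.cls n 4)) ∧
    (∀ (t : ℕ) (x x' y y' z z' : Fin n) (A B C K I : Set (Fin n)),
      NestedRuleApplies G k t A B C K I → DeterminedBy G x x' y y' z z' A B C K I →
      s.reg 0 ≠ 0) := by
  refine Runs.const_seq (Runs.add_seq ?_)
  set s₀ := ((State.init n k).setReg 3 0).setReg 2
    (((State.init n k).setReg 3 0).reg 1 + ((State.init n k).setReg 3 0).reg 3) with hs₀
  have hk : envOf s₀ 0 = k := by simp [hs₀, envOf, State.init]
  refine (runs_search avoids_ruleExpr _ (by simp) s₀ (by simp [hs₀, State.init])).seq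
    fun s₁ ⟨h1, h2, h3⟩ => ?_
  refine (runs_fill s₁ h1).seq fun s₂ ⟨h4, h5, h6⟩ => ?_
  refine (runs_compile G ruleExpr 0 s₂ h4).seq fun s₃ ⟨h7, h8⟩ => ?_
  refine Runs.const_seq (Runs.add_seq (Runs.add ?_))
  have hk₂ : envOf s₂ 0 = k := by rw [h5 0 (by omega), h2 0 (by simp), hk]
  have h7' : s₃.reg 1 = ruleExpr.eval G (envOf s₂) := h7
  have ht : s₃.reg 4 = envOf s₂ 1 := h8.2 4 (by omega)
  set s₄ := ((s₃.setReg 3 0).setReg 0 ((s₃.setReg 3 0).reg 1 + (s₃.setReg 3 0).reg 3)).setReg 1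
    (((s₃.setReg 3 0).setReg 0 ((s₃.setReg 3 0).reg 1 + (s₃.setReg 3 0).reg 3)).reg 4 +
    ((s₃.setReg 3 0).setReg 0 ((s₃.setReg 3 0).reg 1 + (s₃.setReg 3 0).reg 3)).reg 3) with hs₄
  have r0 : s₄.reg 0 = ruleExpr.eval G (envOf s₂) := by simp [hs₄, h7']
  have r1 : s₄.reg 1 = envOf s₂ 1 := by simp [hs₄, ht]
  have hcls : ∀ j, s₄.cls n j = partSet G (envOf s₂) j := by
    intro j
    rw [partSet_congr h5]
    ext v
    show s₃.mem v = j ↔ _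
    rw [h8.1, h6 v v.2]
    rfl
  rw [r0, r1]
  simp only [hcls]
  refine ⟨fun h => ?_, fun t x x' y y' z z' A B C K I hrule hdet => ?_⟩
  · have := holds_ruleExpr.1 h
    rwa [hk₂] at this
  · refine (holds_ruleExpr_congr h5).2 (h3 ?_)
    -- Bounded quantifiers range over values below `n`, which suffices for `t` because `k + t < |A|
    -- ≤ n`.
    have htn : t < n := by
      have h9 := hrule.1.card_A
      have h10 : A.ncard ≤ n := by
        have := Set.ncard_le_ncard (Set.subset_univ A) (Set.toFinite _)
        simpa [Set.ncard_univ] using this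
      omega
    simp only [exs, holds_ex]
    refine ⟨⟨t, htn⟩, x, x', y, y', z, z', holds_ruleExpr.2 ?_⟩
    obtain ⟨p0, p1, p2, p3, p4⟩ := partSet_eq (env := Function.update (Function.update
      (Function.update (Function.update (Function.update (Function.update (Function.update
      (envOf s₀) 1 t) 2 x) 3 x') 4 y) 5 y') 6 z) 7 z') hdet (by simp) (by simp) (by simp)
      (by simp) (by simp) (by simp)
    rw [p0, p1, p2, p3, p4]
    simpa [hk] using hrule

theorem exists_detectCost_le : ∃ c d, ∀ n, detectCost n ≤ c * (n + 1) ^ d := by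
  have hadd : ∀ {f g : ℕ → ℕ}, (∃ c d, ∀ n, f n ≤ c * (n + 1) ^ d) →
      (∃ c d, ∀ n, g n ≤ c * (n + 1) ^ d) → ∃ c d, ∀ n, f n + g n ≤ c * (n + 1) ^ d := by
    rintro f g ⟨c, d, h⟩ ⟨c', d', h'⟩
    refine ⟨c + c', d + d', fun n => ?_⟩
    have h1 : (n + 1) ^ d ≤ (n + 1) ^ (d + d') := Nat.pow_le_pow_right (by omega) (by omega)
    have h2 : (n + 1) ^ d' ≤ (n + 1) ^ (d + d') := Nat.pow_le_pow_right (by omega) (by omega)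
    rw [add_mul]
    exact add_le_add ((h n).trans (Nat.mul_le_mul_left c h1))
      ((h' n).trans (Nat.mul_le_mul_left c' h2))
  have hconst : ∀ a : ℕ, ∃ c d, ∀ n, a ≤ c * (n + 1) ^ d := fun a => ⟨a, 0, fun n => by simp⟩
  have hmul : ∀ {f : ℕ → ℕ}, (∃ c d, ∀ n, f n ≤ c * (n + 1) ^ d) →
      ∃ c d, ∀ n, n * f n ≤ c * (n + 1) ^ d := by
    rintro f ⟨c, d, h⟩
    refine ⟨c, d + 1, fun n => ?_⟩
    calc n * f n ≤ (n + 1) * (c * (n + 1) ^ d) := Nat.mul_le_mul (by omega) (h n)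
      _ = c * (n + 1) ^ (d + 1) := by ring
  have hsearch : ∀ (e : CountExpr) (l : List ℕ), ∃ c d, ∀ n, searchCost n e l ≤ c * (n + 1) ^ d := by
    intro e l
    induction l with
    | nil => exact hconst 1
    | cons i l ih => exact hadd (hadd (exists_cost_le _) (hconst _)) ih
  exact hadd (hconst 1) (hadd (hconst 1) (hadd (hsearch _ _) (hadd (hadd (hconst 1)
    (hadd (hconst 1) (hadd (hmul (hadd (hadd (hconst 1) (hadd (hconst 1)
      (hadd (exists_cost_le _) (hconst 1)))) (hconst 1))) (hconst 1))))
    (hadd (exists_cost_le _) (hconst _)))))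

end CountExpr
end CographEdit

open CographEdit
theorem mainTheorem2 :
    -- a 51-sparse path of the forest forces an applicable nested `t`-module, which is moreover
    -- determined by six vertices
    (∀ (V : Type*) [Fintype V] (N : Type*) [Fintype N] (G : SimpleGraph V) (k : ℕ)
      (S : Finset (Sym2 V)) (T : Cotree (edit G S) N),
      IsReducedInstance G k → IsMinCographEdit G S → S.card ≤ k →
      (∃ a b : N, T.IsSparsePath S k 51 a b) →
      ∃ (t : ℕ) (A B C K I : Set V), NestedRuleApplies G k t A B C K I ∧
        ∃ x x' y y' z z' : V, DeterminedBy G x x' y y' z z' A B C K I) ∧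
    -- one program detects such a nested `t`-module in time polynomial in the number of vertices
    (∃ (P : Program) (c d : ℕ), ∀ (n : ℕ) (G : SimpleGraph (Fin n)) (k : ℕ),
      ∃ (τ : ℕ) (s : State), Exec G P (State.init n k) τ s ∧ τ ≤ c * (n + 1) ^ d ∧
        (s.reg 0 ≠ 0 → NestedRuleApplies G k (s.reg 1)
          (s.cls n 0) (s.cls n 1) (s.cls n 2) (s.cls n 3) (s.cls n 4)) ∧
        (∀ (N : Type*) [Fintype N] (S : Finset (Sym2 (Fin n))) (T : Cotree (edit G S) N),
          IsReducedInstance G k → IsMinCographEdit G S → S.card ≤ k →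
          (∃ a b : N, T.IsSparsePath S k 51 a b) → s.reg 0 ≠ 0)) := by
  refine ⟨?_, ?_⟩
  · rintro V _ N _ G k S T hG - - ⟨a, b, h⟩
    exact exists_nestedRuleApplies_of_isSparsePath hG h
  · obtain ⟨c, d, hcd⟩ := CountExpr.exists_detectCost_le
    refine ⟨CountExpr.detect, c, d, fun n G k => ?_⟩
    obtain ⟨τ, s, hexec, hτ, hsound, hcomplete⟩ := CountExpr.runs_detect (G := G) k
    refine ⟨τ, s, hexec, hτ.trans (hcd n), hsound, ?_⟩
    rintro N _ S T hG - - ⟨a, b, h⟩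
    obtain ⟨t, A, B, C, K, I, hrule, x, x', y, y', z, z', hdet⟩ :=
      exists_nestedRuleApplies_of_isSparsePath hG h
    exact hcomplete t x x' y y' z z' A B C K I hrule hdet
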